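/- Let $d\in\mathbb N$, let $\mathcal H$ be a complex Hilbert space, let $0<p<\infty$, and let $\nu:\mathbb Z^d\to[0,\infty)$ be an admissible weight, that is, $\nu(x+y)\le\nu(x)\nu(y)$, $\nu(-x)=\nu(x)$ and $\lim_{n\to\infty}\nu(nx)^{1/n}=1$ for all $x,y\in\mathbb Z^d$. If $p>1$, let $p'=p/(p-1)$ and assume also that $\nu$ is a $p$-algebra weight, that is, $\sum_{m\in\mathbb Z^d}\nu(m)^{-p'}\nu(n-m)^{-p'}\le\nu(n)^{-p'}$ for all $n\in\mathbb Z^d$, and that $\sum_{n\in\mathbb Z^d}\nu(n)^{-p'}<\infty$. Let $\mathcal C^p_\nu$ be the set of all $B(\mathcal H)$-valued matrices $A=[A_{k,l}]_{k,l\in\mathbb Z^d}$ with $$|A|=\sum_{l\in\mathbb Z^d}\Big(\sup_{k\in\mathbb Z^d}\|A_{k,k-l}\|\Big)^p\nu(l)^p<\infty .$$ Then every $A\in\mathcal C^p_\nu$ acts as a bounded operator on $\ell^2(\mathbb Z^d,\mathcal H)$ by $(Ax)_k=\sum_{l}A_{k,l}x_l$ and, with each such matrix identified with the operator it defines, $\mathcal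 C^p_\nu$ is a unital $*$-subalgebra of $B(\ell^2(\mathbb Z^d,\mathcal H))$ which is inverse closed: if $A\in\mathcal C^p_\nu$ is invertible in $B(\ell^2(\mathbb Z^d,\mathcal H))$, then $A^{-1}\in\mathcal C^p_\nu$. In particular, $\mathcal C^p_\nu$ is a symmetric $p$-Banach $*$-algebra with the $p$-norm $|\cdot|$ if $p\le1$, and a symmetric Banach $*$-algebra with the norm $|\cdot|^{1/p}$ if $p>1$. Here, for $0<r\le1$, an $r$-Banach $*$-algebra is a complex $*$-algebra with a map $N$ to $[0,\infty)$ such that $N(x)=0$ if and only if $x=0$, $N(x+y)\le N(x)+N(y)$, $N(\alpha x)=|\alpha|^rN(x)$ for $\alpha\in\mathbb C$, $N(xy)\le N(x)N(y)$, $N(x^*)=N(x)$, and every $N$-Cauchy sequence converges; a Banach $*$-algebra is the case $r=1$; and the algebra is symmetric if the spectrum of $aa^*$ in it is contained in $[0,\infty)$ for each of its elements $a$. -/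

import Mathlib

open scoped NNReal ENNReal
open Filter Topology

noncomputable section

namespace BGS

/-! ### Weights on the lattice -/

/-- Admissible weights on `ℤ^d`: submultiplicative, symmetric, and satisfying the
GRS condition `lim ν(n x)^{1/n} = 1` for every `x`. -/
structure IsAdmissible {d : ℕ} (ν : (Fin d → ℤ) → ℝ≥0) : Prop where
  submul : ∀ x y, ν (x + y) ≤ ν x * ν y
  symm : ∀ x, ν (-x) = ν x
  grs : ∀ x, Tendsto (fun n : ℕ => ν (n • x) ^ (1 / (n : ℝ))) atTop (𝓝 1)

/-- The `p`-algebra condition `ν^{-p'} ⋆ ν^{-p'} ≤ ν^{-p'}` (convolution on `ℤ^d`),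
where `1/p + 1/p' = 1`. -/
def IsPAlgebraWeight {d : ℕ} (p : ℝ) (ν : (Fin d → ℤ) → ℝ≥0) : Prop :=
  ∀ n, ∑' m, (ν m : ℝ≥0∞) ^ (-p.conjExponent) * (ν (n - m) : ℝ≥0∞) ^ (-p.conjExponent)
    ≤ (ν n : ℝ≥0∞) ^ (-p.conjExponent)

/-! ### Operator-valued matrices and operators on `ℓ²(ℤ^d, H)` -/

/-- The space `ℓ²(ℤ^d, H)`. -/
abbrev L2 (d : ℕ) (H : Type*) [NormedAddCommGroup H] : Type _ :=
  lp (fun _ : Fin d → ℤ => H) 2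

/-- Matrices indexed by `ℤ^d` with entries in `B(H)`. -/
abbrev OpMatrix (d : ℕ) (H : Type*) [NormedAddCommGroup H] [InnerProductSpace ℂ H] : Type _ :=
  (Fin d → ℤ) → (Fin d → ℤ) → (H →L[ℂ] H)

section

variable {d : ℕ} {H : Type*} [NormedAddCommGroup H] [InnerProductSpace ℂ H]

/-- The `k`-th coordinate map `x ↦ x_k` on `ℓ²(ℤ^d, H)`. -/
def coord (k : Fin d → ℤ) : L2 d H →L[ℂ] H :=
  LinearMap.mkContinuous
    { toFun := fun x => x k
      map_add' := fun _ _ => rfl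
      map_smul' := fun _ _ => rfl } 1
    (fun x => (lp.norm_apply_le_norm two_ne_zero x k).trans_eq (one_mul _).symm)

@[simp] theorem coord_apply (k : Fin d → ℤ) (x : L2 d H) : coord k x = x k := rfl

/-- The canonical matrix `[T_{k,l}]` of a bounded operator `T` on `ℓ²(ℤ^d, H)`. -/
def canonicalMatrix (T : L2 d H →L[ℂ] L2 d H) : OpMatrix d H := fun k l =>
  (coord k).comp (T.comp (lp.singleContinuousLinearMap ℂ (fun _ : Fin d → ℤ => H) 2 l))

/-- `A` is the canonical matrix of `T` iff `(T x)_k = ∑_l A_{k,l} x_l` for all `x` and `k`. -/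
theorem canonicalMatrix_eq_iff (T : L2 d H →L[ℂ] L2 d H) (A : OpMatrix d H) :
    canonicalMatrix T = A ↔
      ∀ (x : L2 d H) (k : Fin d → ℤ), HasSum (fun l => A k l (x l)) (T x k) := by
  constructor
  · rintro rfl x k
    have h := lp.hasSum_single (E := fun _ : Fin d → ℤ => H) (p := 2) (by simp) x
    exact h.mapL ((coord k).comp T)
  · intro h
    funext k l
    ext v
    have h1 := h (lp.single 2 l v) k
    have h2 := hasSum_single (f := fun m => A k m ((lp.single 2 l v : L2 d H) m)) l
      (fun m hm => by rw [lp.single_apply_ne _ _ _ hm, map_zero])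
    have h3 := h1.unique h2
    simpa [canonicalMatrix] using h3

/-- The canonical matrix of a composition is the matrix product. -/
theorem hasSum_canonicalMatrix_mul (S T : L2 d H →L[ℂ] L2 d H) (k l : Fin d → ℤ) (v : H) :
    HasSum (fun m => canonicalMatrix S k m (canonicalMatrix T m l v))
      (canonicalMatrix (S * T) k l v) :=
  (canonicalMatrix_eq_iff S _).1 rfl (T (lp.single 2 l v)) k

/-- The canonical matrix of the Hilbert space adjoint is the transposed matrix of adjoints. -/
theorem canonicalMatrix_star [CompleteSpace H] (T : L2 d H →L[ℂ] L2 d H) (k l : Fin d → ℤ) :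
    canonicalMatrix (star T) k l = star (canonicalMatrix T l k) := by
  ext v
  refine ext_inner_right ℂ fun w => ?_
  have h1 := lp.inner_single_right (𝕜 := ℂ) (G := fun _ : Fin d → ℤ => H) k w
    (star T (lp.single 2 l v))
  have h2 := lp.inner_single_left (𝕜 := ℂ) (G := fun _ : Fin d → ℤ => H) l v
    (T (lp.single 2 k w))
  rw [ContinuousLinearMap.star_eq_adjoint, ContinuousLinearMap.adjoint_inner_left] at h1
  rw [ContinuousLinearMap.star_eq_adjoint, ContinuousLinearMap.star_eq_adjoint,
    ContinuousLinearMap.adjoint_inner_left]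
  exact h1.symm.trans h2

/-! ### The weighted Baskakov–Gohberg–Sjöstrand class -/

/-- `∑_l (sup_k ‖A_{k,k-l}‖)^p ν(l)^p`, as an extended nonnegative real number. -/
def bgsSum (p : ℝ) (ν : (Fin d → ℤ) → ℝ≥0) (A : OpMatrix d H) : ℝ≥0∞ :=
  ∑' l, (⨆ k, ‖A k (k - l)‖ₑ) ^ p * (ν l : ℝ≥0∞) ^ p

/-- The class `C^p_ν` of `B(H)`-valued matrices. -/
def bgsClass (d : ℕ) (H : Type*) [NormedAddCommGroup H] [InnerProductSpace ℂ H]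
    (p : ℝ) (ν : (Fin d → ℤ) → ℝ≥0) : Set (OpMatrix d H) :=
  {A | bgsSum p ν A < ∞}

/-- The `p`-norm (if `p ≤ 1`), respectively the norm (if `p > 1`), of `C^p_ν`. -/
def bgsNorm (p : ℝ) (ν : (Fin d → ℤ) → ℝ≥0) (A : OpMatrix d H) : ℝ :=
  if p ≤ 1 then (bgsSum p ν A).toReal else (bgsSum p ν A).toReal ^ (1 / p)

end

/-! ### Notions about algebras -/

/-- `N` makes the complex `*`-algebra `𝒜` an `r`-Banach `*`-algebra (a Banach `*`-algebra if
`r = 1`): `N` is a complete submultiplicative `r`-norm for which the involution is isometric. -/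
structure IsPBanachStarAlgebra (r : ℝ) {𝒜 : Type*} [Ring 𝒜] [StarRing 𝒜] [Algebra ℂ 𝒜]
    [StarModule ℂ 𝒜] (N : 𝒜 → ℝ) : Prop where
  nonneg : ∀ a, 0 ≤ N a
  eq_zero_iff : ∀ a, N a = 0 ↔ a = 0
  add_le : ∀ a b, N (a + b) ≤ N a + N b
  smul_eq : ∀ (c : ℂ) (a : 𝒜), N (c • a) = ‖c‖ ^ r * N a
  mul_le : ∀ a b, N (a * b) ≤ N a * N b
  star_eq : ∀ a, N (star a) = N a
  complete : ∀ u : ℕ → 𝒜,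
    (∀ ε > 0, ∃ n₀, ∀ m ≥ n₀, ∀ n ≥ n₀, N (u m - u n) < ε) →
      ∃ a, Tendsto (fun n => N (u n - a)) atTop (𝓝 0)

/-- A complex `*`-algebra is symmetric if `σ(a a^*) ⊆ [0, ∞)` for all `a`. -/
def IsSymmetricAlgebra (𝒜 : Type*) [Ring 𝒜] [StarRing 𝒜] [Algebra ℂ 𝒜] : Prop :=
  ∀ a : 𝒜, spectrum ℂ (a * star a) ⊆ Complex.ofReal '' Set.Ici 0

/-- A subalgebra (with the same unit) is inverse closed if each of its elements that is
invertible in the large algebra is invertible in the subalgebra. -/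
def IsInverseClosed {ℬ : Type*} [Ring ℬ] [Algebra ℂ ℬ] (S : Subalgebra ℂ ℬ) : Prop :=
  ∀ a : S, IsUnit (a : ℬ) → IsUnit a

end BGS

end

noncomputable section

namespace BGS

/-! ### Inequalities for sums of extended nonnegative reals -/

/-! Everything is controlled by the sequence `diagSup A` of suprema along the side diagonals. A
product of operators has diagonal sequence dominated by the convolution of the two
(`diagSup_mul_le`), and the adjoint reflects it. So the algebra and norm inequalities are statements
about nonnegative sequences in weighted `ℓ^p`, where convolution is submultiplicative
(`seqNorm_mul_le`). Sequences take values in `[0, ∞]`, so no summability has to be checked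
beforehand. As weighted `ℓ^p` embeds in `ℓ¹`, a matrix of the class is a norm convergent sum of its
diagonals, hence a bounded operator.

Inverse closedness has two stages. Without weight and with `p = 1` (`tsum_diagSup_inverse_lt_top`),
it is a localization argument. Let `χ_j` be tent functions on cubes of side `N`. From `χ_j u = S T
χ_j u` one gets `‖χ_j u‖ ≤ ‖S‖ (‖χ_j T u‖ + ‖[T, χ_j] u‖)`. The commutator term is at most a
convolution of `(‖χ_i u‖)_i` with a sequence whose `ℓ¹` norm tends to `0` as `N → ∞`. Once that norm
is below `1`, a Neumann series solves the inequality; taking `u = S δ_m v` bounds the diagonals of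
`S`.

The weight enters through a spectral radius estimate (`tsum_seqNorm_pow_lt_top`): by the GRS
condition `ν` grows subexponentially, so powers of a nonnegative sequence of `ℓ¹` norm below `1`
have summable weighted norms. Now truncate `S` to finitely many diagonals, giving `B` in the class
with `R = 1 - T B` of `ℓ¹` norm below `1`. Then `∑ R^n` lies in the class, and so does `S = B ∑
R^n`.

Symmetry follows from inverse closedness in a C*-algebra. Completeness holds because the class norm
dominates the operator norm topology and its balls are closed there. -/

theorem rpow_tsum_le_tsum_rpow {ι : Type*} (f : ι → ℝ≥0∞) {p : ℝ} (hp : 0 < p) (hp1 : p ≤ 1) :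
    (∑' i, f i) ^ p ≤ ∑' i, f i ^ p := by
  have h1 : Tendsto (fun s : Finset ι => (∑ i ∈ s, f i) ^ p) atTop (𝓝 ((∑' i, f i) ^ p)) :=
    (ENNReal.continuous_rpow_const.tendsto _).comp ENNReal.summable.hasSum
  refine le_of_tendsto h1 (Eventually.of_forall fun s => ?_)
  refine le_trans ?_ (ENNReal.sum_le_tsum s)
  classical
  induction s using Finset.induction_on with
  | empty => simp [hp]
  | insert a s ha ih =>
    rw [Finset.sum_insert ha, Finset.sum_insert ha]
    exact (ENNReal.rpow_add_le_add_rpow _ _ hp.le hp1).trans (by gcongr)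

theorem tsum_Lp_add_le {ι : Type*} (f g : ι → ℝ≥0∞) {p : ℝ} (hp : 1 ≤ p) :
    (∑' i, (f i + g i) ^ p) ^ (1 / p) ≤
      (∑' i, f i ^ p) ^ (1 / p) + (∑' i, g i ^ p) ^ (1 / p) := by
  let _ : MeasurableSpace ι := ⊤
  have := ENNReal.lintegral_Lp_add_le (μ := MeasureTheory.Measure.count) (f := f) (g := g)
    (measurable_from_top.aemeasurable) (measurable_from_top.aemeasurable) hp
  simpa [MeasureTheory.lintegral_count] using this

theorem tsum_mul_le_Lp_mul_Lq {ι : Type*} (f g : ι → ℝ≥0∞) {p q : ℝ}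
    (hpq : p.HolderConjugate q) :
    ∑' i, f i * g i ≤ (∑' i, f i ^ p) ^ (1 / p) * (∑' i, g i ^ q) ^ (1 / q) := by
  let _ : MeasurableSpace ι := ⊤
  have := ENNReal.lintegral_mul_le_Lp_mul_Lq (MeasureTheory.Measure.count) hpq (f := f) (g := g)
    (measurable_from_top.aemeasurable) (measurable_from_top.aemeasurable)
  simpa [MeasureTheory.lintegral_count] using this

/-! ### The convolution semiring of `[0, ∞]`-valued functions on an abelian group -/

/-- Functions `G → [0, ∞]`, with convolution as multiplication. -/
@[ext]
structure ConvSeq (G : Type*) where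
  /-- The underlying function. -/
  toFun : G → ℝ≥0∞

namespace ConvSeq

variable {G : Type*}

instance : CoeFun (ConvSeq G) fun _ => G → ℝ≥0∞ := ⟨toFun⟩

instance : Add (ConvSeq G) := ⟨fun a b => ⟨fun l => a l + b l⟩⟩

instance : Zero (ConvSeq G) := ⟨⟨fun _ => 0⟩⟩

theorem add_apply (a b : ConvSeq G) (l : G) : (a + b) l = a l + b l := rfl

theorem zero_apply (l : G) : (0 : ConvSeq G) l = 0 := rfl

variable [AddCommGroup G]

instance : Mul (ConvSeq G) := ⟨fun a b => ⟨fun l => ∑' m, a m * b (l - m)⟩⟩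

open Classical in
instance : One (ConvSeq G) := ⟨⟨fun l => if l = 0 then 1 else 0⟩⟩

theorem mul_apply (a b : ConvSeq G) (l : G) : (a * b) l = ∑' m, a m * b (l - m) := rfl

open Classical in
theorem one_apply (l : G) : (1 : ConvSeq G) l = if l = 0 then 1 else 0 := rfl

theorem mul_comm' (a b : ConvSeq G) : a * b = b * a := by
  ext l
  rw [mul_apply, mul_apply, ← (Equiv.subLeft l).tsum_eq]
  refine tsum_congr fun m => ?_
  simp [mul_comm]

theorem one_mul' (a : ConvSeq G) : 1 * a = a := by
  ext l
  rw [mul_apply, tsum_eq_single 0]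
  · simp [one_apply]
  · intro m hm
    simp [one_apply, hm]

theorem mul_assoc' (a b c : ConvSeq G) : a * b * c = a * (b * c) := by
  ext l
  simp only [mul_apply, ← ENNReal.tsum_mul_right, ← ENNReal.tsum_mul_left]
  rw [ENNReal.tsum_comm]
  refine tsum_congr fun n => ?_
  rw [← (Equiv.addRight n).tsum_eq]
  refine tsum_congr fun m => ?_
  simp only [Equiv.coe_addRight, add_sub_cancel_right, mul_assoc]
  congr 3
  abel

theorem add_mul' (a b c : ConvSeq G) : (a + b) * c = a * c + b * c := by
  ext l
  simp only [mul_apply, add_apply, add_mul, ENNReal.tsum_add]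

instance : CommSemiring (ConvSeq G) where
  add_assoc a b c := by ext l; simp only [add_apply, add_assoc]
  add_comm a b := by ext l; simp only [add_apply, add_comm]
  zero_add a := by ext l; simp only [add_apply, zero_apply, zero_add]
  add_zero a := by ext l; simp only [add_apply, zero_apply, add_zero]
  mul_assoc := mul_assoc'
  mul_comm := mul_comm'
  one_mul := one_mul'
  mul_one a := by rw [mul_comm', one_mul']
  zero_mul a := by ext l; simp [mul_apply, zero_apply]
  mul_zero a := by ext l; simp [mul_apply, zero_apply]
  right_distrib := add_mul'
  left_distrib a b c := by rw [mul_comm', add_mul', mul_comm' b, mul_comm' c]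
  nsmul := nsmulRec

theorem sum_apply {ι : Type*} (s : Finset ι) (f : ι → ConvSeq G) (l : G) :
    (∑ i ∈ s, f i) l = ∑ i ∈ s, f i l := by
  classical
  induction s using Finset.induction_on with
  | empty => simp [zero_apply]
  | insert a s ha ih => rw [Finset.sum_insert ha, Finset.sum_insert ha, add_apply, ih]

theorem mul_le_mul_apply {a a' b b' : ConvSeq G} (ha : ∀ l, a l ≤ a' l) (hb : ∀ l, b l ≤ b' l)
    (l : G) : (a * b) l ≤ (a' * b') l :=
  ENNReal.tsum_le_tsum fun m => mul_le_mul' (ha m) (hb _)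

theorem tsum_mul_weight_le {w : G → ℝ≥0∞} (hw : ∀ x y, w (x + y) ≤ w x * w y)
    (a b : ConvSeq G) :
    ∑' l, (a * b) l * w l ≤ (∑' l, a l * w l) * ∑' l, b l * w l := by
  simp only [mul_apply, ← ENNReal.tsum_mul_right]
  rw [ENNReal.tsum_comm]
  refine ENNReal.tsum_le_tsum fun m => ?_
  rw [← ENNReal.tsum_mul_left, ← (Equiv.addLeft m).tsum_eq]
  refine ENNReal.tsum_le_tsum fun l => ?_
  simp only [Equiv.coe_addLeft, add_sub_cancel_left]
  calc a m * b l * w (m + l) ≤ a m * b l * (w m * w l) := by gcongr; exact hw m l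
    _ = _ := by ring

theorem tsum_pow_weight_le {w : G → ℝ≥0∞} (hw : ∀ x y, w (x + y) ≤ w x * w y) (h0 : w 0 ≤ 1)
    (a : ConvSeq G) (n : ℕ) :
    ∑' l, (a ^ n) l * w l ≤ (∑' l, a l * w l) ^ n := by
  induction n with
  | zero =>
    rw [pow_zero, pow_zero, tsum_eq_single 0]
    · simpa [one_apply] using h0
    · intro m hm
      simp [one_apply, hm]
  | succ n ih =>
    rw [pow_succ, pow_succ]
    exact (tsum_mul_weight_le hw _ _).trans (by gcongr)

theorem tsum_mul_le (a b : ConvSeq G) : ∑' l, (a * b) l ≤ (∑' l, a l) * ∑' l, b l := by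
  simpa using tsum_mul_weight_le (w := fun _ => 1) (by simp) a b

theorem tsum_pow_le (a : ConvSeq G) (n : ℕ) : ∑' l, (a ^ n) l ≤ (∑' l, a l) ^ n := by
  simpa using tsum_pow_weight_le (w := fun _ => 1) (by simp) (by simp) a n

theorem apply_mul_le {a b : ConvSeq G} {C : ℝ≥0∞} (hb : ∀ l, b l ≤ C) (l : G) :
    (a * b) l ≤ (∑' l, a l) * C := by
  rw [mul_apply, ← ENNReal.tsum_mul_right]
  exact ENNReal.tsum_le_tsum fun m => by gcongr; exact hb _

/-- A bounded solution of `u ≤ f + a ⋆ u` with `‖a‖₁ < 1` is dominated by the Neumann series. -/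
theorem le_tsum_pow_mul {a u f : ConvSeq G} {C : ℝ≥0∞} (hC : C ≠ ∞) (hu : ∀ l, u l ≤ C)
    (ha : ∑' l, a l < 1) (h : ∀ l, u l ≤ f l + (a * u) l) (l : G) :
    u l ≤ ((⟨fun m => ∑' n : ℕ, (a ^ n) m⟩ : ConvSeq G) * f) l := by
  set b : ConvSeq G := ⟨fun m => ∑' n : ℕ, (a ^ n) m⟩ with hb
  -- Iterate the inequality `M` times. The remainder `a ^ M * u` is at most `‖a‖₁ ^ M * C`, which
  -- vanishes in the limit because `C` is finite.
  have key : ∀ M : ℕ, ∀ l, u l ≤ ((∑ n ∈ Finset.range M, a ^ n) * f) l + (a ^ M * u) l := by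
    intro M
    induction M with
    | zero => intro l; simp [zero_apply]
    | succ M ih =>
      intro l
      refine (ih l).trans ?_
      have h1 : (a ^ M * u) l ≤ (a ^ M * (f + a * u)) l :=
        mul_le_mul_apply (fun _ => le_rfl) h l
      rw [mul_add, add_apply, ← mul_assoc, ← pow_succ] at h1
      rw [Finset.sum_range_succ, add_mul, add_apply, add_assoc]
      gcongr
  have h2 : ∀ M : ℕ, u l ≤ (b * f) l + (∑' l, a l) ^ M * C := by
    intro M
    refine (key M l).trans (add_le_add (mul_le_mul_apply (fun m => ?_) (fun _ => le_rfl) l) ?_)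
    · rw [sum_apply]
      exact ENNReal.sum_le_tsum (f := fun n => (a ^ n) m) _
    · refine (apply_mul_le hu l).trans ?_
      gcongr
      exact tsum_pow_le a M
  have h3 : Tendsto (fun M : ℕ => (b * f) l + (∑' l, a l) ^ M * C) atTop (𝓝 ((b * f) l + 0 * C)) :=
    (ENNReal.Tendsto.mul_const (ENNReal.tendsto_pow_atTop_nhds_zero_of_lt_one ha)
      (Or.inr hC)).const_add _
  rw [zero_mul, add_zero] at h3
  exact ge_of_tendsto' h3 h2

theorem tsum_tsum_pow_lt_top {a : ConvSeq G} (ha : ∑' l, a l < 1) :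
    ∑' l, ∑' n : ℕ, (a ^ n) l < ∞ := by
  rw [ENNReal.tsum_comm]
  refine (ENNReal.tsum_le_tsum fun n => tsum_pow_le a n).trans_lt ?_
  rw [ENNReal.tsum_geometric]
  exact ENNReal.inv_lt_top.2 (tsub_pos_of_lt ha)

end ConvSeq

/-! ### Weighted `ℓ^p` (quasi-)norms of nonnegative sequences -/

section WeightedNorms

variable {G : Type*} {p : ℝ} {ν : G → ℝ≥0}

/-- `∑_l a_l^p ν(l)^p`. -/
def weightedSum (p : ℝ) (ν : G → ℝ≥0) (a : G → ℝ≥0∞) : ℝ≥0∞ := ∑' l, a l ^ p * (ν l : ℝ≥0∞) ^ p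

/-- The `p`-norm (`p ≤ 1`) or norm (`p > 1`) of the weighted `ℓ^p`-space. -/
def seqNorm (p : ℝ) (ν : G → ℝ≥0) (a : G → ℝ≥0∞) : ℝ≥0∞ :=
  if p ≤ 1 then weightedSum p ν a else weightedSum p ν a ^ (1 / p)

theorem seqNorm_lt_top_iff (hp : 0 < p) (a : G → ℝ≥0∞) :
    seqNorm p ν a < ∞ ↔ weightedSum p ν a < ∞ := by
  unfold seqNorm
  split_ifs
  · rfl
  · exact ENNReal.rpow_lt_top_iff_of_pos (by positivity)

/-- Lets closedness of balls be proved for `weightedSum`, without the case distinction on `p`. -/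
theorem exists_seqNorm_le_iff_weightedSum_le (hp : 0 < p) (ν : G → ℝ≥0) (c : ℝ≥0∞) :
    ∃ c' : ℝ≥0∞, ∀ a : G → ℝ≥0∞, seqNorm p ν a ≤ c ↔ weightedSum p ν a ≤ c' := by
  unfold seqNorm
  split_ifs
  · exact ⟨c, fun _ => Iff.rfl⟩
  · refine ⟨c ^ p, fun a => ?_⟩
    rw [one_div, ENNReal.rpow_inv_le_iff hp]

theorem weightedSum_mono (hp : 0 < p) {a b : G → ℝ≥0∞} (h : ∀ l, a l ≤ b l) :
    weightedSum p ν a ≤ weightedSum p ν b :=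
  ENNReal.tsum_le_tsum fun l => by gcongr; exact h l

theorem seqNorm_mono (hp : 0 < p) {a b : G → ℝ≥0∞} (h : ∀ l, a l ≤ b l) :
    seqNorm p ν a ≤ seqNorm p ν b := by
  unfold seqNorm
  split_ifs
  · exact weightedSum_mono hp h
  · gcongr
    exact weightedSum_mono hp h

theorem seqNorm_add_le (hp : 0 < p) (a b : G → ℝ≥0∞) :
    seqNorm p ν (fun l => a l + b l) ≤ seqNorm p ν a + seqNorm p ν b := by
  unfold seqNorm weightedSum
  split_ifs with h
  · rw [← ENNReal.tsum_add]
    refine ENNReal.tsum_le_tsum fun l => ?_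
    rw [← add_mul]
    gcongr
    exact ENNReal.rpow_add_le_add_rpow _ _ hp.le h
  · have := tsum_Lp_add_le (fun l => a l * ν l) (fun l => b l * ν l) (not_le.1 h).le
    simpa only [← add_mul, ENNReal.mul_rpow_of_nonneg _ _ hp.le] using this

/-- The degree of homogeneity `min p 1` covers both regimes: no root is taken for `p ≤ 1`, while the
`p`-th root is taken for `p > 1`. -/
theorem seqNorm_const_mul (hp : 0 < p) (c : ℝ≥0∞) (a : G → ℝ≥0∞) :
    seqNorm p ν (fun l => c * a l) = c ^ min p 1 * seqNorm p ν a := by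
  have : weightedSum p ν (fun l => c * a l) = c ^ p * weightedSum p ν a := by
    unfold weightedSum
    rw [← ENNReal.tsum_mul_left]
    exact tsum_congr fun l => by rw [ENNReal.mul_rpow_of_nonneg _ _ hp.le, mul_assoc]
  unfold seqNorm
  rw [this]
  split_ifs with h
  · rw [min_eq_left h]
  · rw [min_eq_right (not_le.1 h).le, ENNReal.mul_rpow_of_nonneg _ _ (by positivity),
      ← ENNReal.rpow_mul, mul_one_div_cancel hp.ne']

theorem seqNorm_zero (hp : 0 < p) : seqNorm p ν (fun _ => 0) = 0 := by
  simp [seqNorm, weightedSum, hp]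

theorem seqNorm_eq_zero_iff (hp : 0 < p) (hν : ∀ l, 1 ≤ ν l) (a : G → ℝ≥0∞) :
    seqNorm p ν a = 0 ↔ ∀ l, a l = 0 := by
  have h0 : ∀ l, ν l ≠ 0 := fun l => (zero_lt_one.trans_le (hν l)).ne'
  have : weightedSum p ν a = 0 ↔ ∀ l, a l = 0 := by
    simp [weightedSum, ENNReal.tsum_eq_zero, hp, hp.not_gt, h0]
  unfold seqNorm
  split_ifs
  · exact this
  · rw [ENNReal.rpow_eq_zero_iff_of_pos (by positivity), this]

theorem seqNorm_comp_neg [AddCommGroup G] (hν : ∀ l, ν (-l) = ν l) (a : G → ℝ≥0∞) :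
    seqNorm p ν (fun l => a (-l)) = seqNorm p ν a := by
  have : weightedSum p ν (fun l => a (-l)) = weightedSum p ν a := by
    unfold weightedSum
    rw [← (Equiv.neg G).tsum_eq]
    simp [hν]
  unfold seqNorm
  rw [this]

/-- A finitely supported sequence with finite values has finite norm. -/
theorem seqNorm_lt_top_of_finite_support (hp : 0 < p) (a : G → ℝ≥0∞) (s : Finset G)
    (hs : ∀ l ∉ s, a l = 0) (ha : ∀ l, a l < ∞) : seqNorm p ν a < ∞ := by
  rw [seqNorm_lt_top_iff hp]
  unfold weightedSum
  rw [tsum_eq_sum (s := s) (fun l hl => by simp [hs l hl, hp])]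
  refine ENNReal.sum_lt_top.2 fun l _ => ENNReal.mul_lt_top ?_ ?_
  · exact ENNReal.rpow_lt_top_of_nonneg hp.le (ha l).ne
  · exact ENNReal.rpow_lt_top_of_nonneg hp.le ENNReal.coe_ne_top

/-- The truncations of a sequence of finite norm outside finite sets have small norm. -/
theorem exists_finset_seqNorm_indicator_compl_lt (hp : 0 < p) {a : G → ℝ≥0∞}
    (ha : seqNorm p ν a < ∞) {ε : ℝ≥0∞} (hε : 0 < ε) :
    ∃ s : Finset G, seqNorm p ν ((s : Set G)ᶜ.indicator a) < ε := by
  have key : ∀ s : Finset G, weightedSum p ν ((s : Set G)ᶜ.indicator a) =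
      ∑' l : {x // x ∉ s}, a l ^ p * (ν l : ℝ≥0∞) ^ p := by
    intro s
    have h := tsum_subtype ((s : Set G)ᶜ) (fun l => a l ^ p * (ν l : ℝ≥0∞) ^ p)
    refine Eq.trans ?_ h.symm
    refine tsum_congr fun l => ?_
    by_cases hl : l ∈ (s : Set G)ᶜ
    · simp only [Set.indicator_of_mem hl]
    · simp [Set.indicator_of_notMem hl, hp]
  have h1 : Tendsto (fun s : Finset G => weightedSum p ν ((s : Set G)ᶜ.indicator a)) atTop (𝓝 0) := by
    simp only [key]
    exact ENNReal.tendsto_tsum_compl_atTop_zero ((seqNorm_lt_top_iff hp a).1 ha).ne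
  have h2 : Tendsto (fun s : Finset G => seqNorm p ν ((s : Set G)ᶜ.indicator a)) atTop (𝓝 0) := by
    unfold seqNorm
    split_ifs
    · exact h1
    · have := (ENNReal.continuous_rpow_const (y := 1 / p)).tendsto 0
      rw [ENNReal.zero_rpow_of_pos (by positivity)] at this
      exact this.comp h1
  exact (h2.eventually (gt_mem_nhds hε)).exists

/-- The weighted `ℓ^p`-space embeds continuously into `ℓ¹`. -/
theorem exists_tsum_le_mul_seqNorm_rpow (hp : 0 < p) (hν : ∀ l, 1 ≤ ν l)
    (hpν : 1 < p → ∑' n, (ν n : ℝ≥0∞) ^ (-p.conjExponent) < ∞) :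
    ∃ K : ℝ≥0∞, K ≠ ∞ ∧ ∀ a : G → ℝ≥0∞, ∑' l, a l ≤ K * seqNorm p ν a ^ (1 / min p 1) := by
  rcases le_or_gt p 1 with h | h
  · refine ⟨1, ENNReal.one_ne_top, fun a => ?_⟩
    have h1 : (∑' l, a l) ^ p ≤ seqNorm p ν a := by
      rw [seqNorm, if_pos h]
      refine (rpow_tsum_le_tsum_rpow a hp h).trans (ENNReal.tsum_le_tsum fun l => ?_)
      refine le_mul_of_one_le_right zero_le (ENNReal.one_le_rpow ?_ hp)
      exact_mod_cast hν l
    rwa [one_mul, min_eq_left h, one_div, ENNReal.le_rpow_inv_iff hp]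
  · have hc : p.HolderConjugate p.conjExponent := Real.HolderConjugate.conjExponent h
    have hq : 0 < p.conjExponent := hc.symm.pos
    refine ⟨(∑' n, (ν n : ℝ≥0∞) ^ (-p.conjExponent)) ^ (1 / p.conjExponent),
      ENNReal.rpow_ne_top_of_nonneg (by positivity) (hpν h).ne, fun a => ?_⟩
    -- For `p > 1` the embedding is Hölder's inequality between `a ν` and `ν⁻¹`, the latter lying in
    -- `ℓ^{p'}` by assumption.
    have h1 : ∑' l, a l = ∑' l, (a l * ν l) * (ν l : ℝ≥0∞)⁻¹ := by
      refine tsum_congr fun l => ?_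
      rw [mul_assoc, ENNReal.mul_inv_cancel, mul_one]
      · exact_mod_cast (zero_lt_one.trans_le (hν l)).ne'
      · exact ENNReal.coe_ne_top
    rw [h1, min_eq_right h.le, div_one, ENNReal.rpow_one, mul_comm, seqNorm, if_neg (not_le.2 h)]
    refine (tsum_mul_le_Lp_mul_Lq _ _ hc).trans (le_of_eq ?_)
    simp only [weightedSum, ENNReal.mul_rpow_of_nonneg _ _ hp.le, ENNReal.inv_rpow,
      ENNReal.rpow_neg]

theorem tsum_lt_top_of_seqNorm_lt_top (hp : 0 < p) (hν : ∀ l, 1 ≤ ν l)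
    (hpν : 1 < p → ∑' n, (ν n : ℝ≥0∞) ^ (-p.conjExponent) < ∞) {a : G → ℝ≥0∞}
    (ha : seqNorm p ν a < ∞) : ∑' l, a l < ∞ := by
  obtain ⟨K, hK, h⟩ := exists_tsum_le_mul_seqNorm_rpow hp hν hpν
  have hr : 0 < min p 1 := lt_min hp one_pos
  exact (h a).trans_lt (ENNReal.mul_lt_top hK.lt_top
    (ENNReal.rpow_lt_top_of_nonneg (by positivity) ha.ne))

section Convolution

variable {d : ℕ} {μ : (Fin d → ℤ) → ℝ≥0}

/-- For `p ≤ 1`, the subadditivity of `t ↦ t ^ p` reduces the claim to the `ℓ¹` convolution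
inequality. For `p > 1`, Hölder is applied to the convolution at `l` with the factor `ν(m)⁻¹
ν(l-m)⁻¹` split off; the `p`-algebra condition bounds the `ℓ^{p'}` norm of that factor by `ν(l)⁻¹`,
and Tonelli sums the rest. -/
theorem seqNorm_mul_le (hp : 0 < p) (hμ : ∀ l, 1 ≤ μ l) (hsub : ∀ x y, μ (x + y) ≤ μ x * μ y)
    (hpμ : 1 < p → IsPAlgebraWeight p μ) (a b : ConvSeq (Fin d → ℤ)) :
    seqNorm p μ (a * b : ConvSeq (Fin d → ℤ)).toFun ≤ seqNorm p μ a * seqNorm p μ b := by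
  set W : (Fin d → ℤ) → ℝ≥0∞ := fun l => (μ l : ℝ≥0∞) with hW
  have hW0 : ∀ l, W l ≠ 0 := fun l => by
    simpa [hW] using (zero_lt_one.trans_le (hμ l)).ne'
  have hWt : ∀ l, W l ≠ ∞ := fun l => ENNReal.coe_ne_top
  have hswap : ∀ f g : (Fin d → ℤ) → ℝ≥0∞,
      ∑' l, ∑' m, f m * g (l - m) = (∑' l, f l) * ∑' l, g l := by
    intro f g
    rw [ENNReal.tsum_comm, ← ENNReal.tsum_mul_right]
    refine tsum_congr fun m => ?_
    rw [ENNReal.tsum_mul_left, ← (Equiv.addRight m).tsum_eq]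
    simp
  unfold seqNorm
  split_ifs with h
  · unfold weightedSum
    rw [← hswap]
    refine ENNReal.tsum_le_tsum fun l => ?_
    rw [ConvSeq.mul_apply]
    calc (∑' m, a m * b (l - m)) ^ p * W l ^ p
        ≤ (∑' m, (a m * b (l - m)) ^ p) * W l ^ p := by
          gcongr
          exact rpow_tsum_le_tsum_rpow _ hp h
      _ ≤ _ := by
          rw [← ENNReal.tsum_mul_right]
          refine ENNReal.tsum_le_tsum fun m => ?_
          have h2 : W l ≤ W m * W (l - m) := by
            have := hsub m (l - m)
            rw [add_sub_cancel] at this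
            simp only [hW]
            exact_mod_cast this
          calc (a m * b (l - m)) ^ p * W l ^ p
              ≤ (a m * b (l - m)) ^ p * (W m * W (l - m)) ^ p := by gcongr
            _ = a m ^ p * W m ^ p * (b (l - m) ^ p * W (l - m) ^ p) := by
              simp only [ENNReal.mul_rpow_of_nonneg _ _ hp.le]
              ring
  · have h' : 1 < p := not_le.1 h
    have hc : p.HolderConjugate p.conjExponent := Real.HolderConjugate.conjExponent h'
    have hq : 0 < p.conjExponent := hc.symm.pos
    rw [← ENNReal.mul_rpow_of_nonneg _ _ (by positivity)]
    refine ENNReal.rpow_le_rpow ?_ (by positivity)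
    unfold weightedSum
    rw [← hswap]
    refine ENNReal.tsum_le_tsum fun l => ?_
    rw [ConvSeq.mul_apply]
    set S := ∑' m, a m ^ p * W m ^ p * (b (l - m) ^ p * W (l - m) ^ p) with hS
    have h1 : ∑' m, a m * b (l - m) ≤ S ^ (1 / p) * (W l)⁻¹ := by
      calc ∑' m, a m * b (l - m)
          = ∑' m, (a m * W m * (b (l - m) * W (l - m))) * ((W m)⁻¹ * (W (l - m))⁻¹) := by
            refine tsum_congr fun m => ?_
            calc a m * b (l - m)
                = a m * (W m * (W m)⁻¹) * (b (l - m) * (W (l - m) * (W (l - m))⁻¹)) := by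
                  rw [ENNReal.mul_inv_cancel (hW0 _) (hWt _),
                    ENNReal.mul_inv_cancel (hW0 _) (hWt _), mul_one, mul_one]
              _ = _ := by ring
        _ ≤ _ := tsum_mul_le_Lp_mul_Lq _ _ hc
        _ ≤ S ^ (1 / p) * (W l)⁻¹ := by
            refine mul_le_mul' (le_of_eq ?_) ?_
            · simp only [ENNReal.mul_rpow_of_nonneg _ _ hp.le, hS]
            · have h3 := hpμ h' l
              calc (∑' m, ((W m)⁻¹ * (W (l - m))⁻¹) ^ p.conjExponent) ^ (1 / p.conjExponent)
                  ≤ (W l ^ (-p.conjExponent)) ^ (1 / p.conjExponent) := by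
                    gcongr
                    simpa only [ENNReal.mul_rpow_of_nonneg _ _ hq.le, ENNReal.inv_rpow,
                      ENNReal.rpow_neg] using h3
                _ = (W l)⁻¹ := by
                    rw [← ENNReal.rpow_mul, neg_mul, mul_one_div_cancel hq.ne',
                      ENNReal.rpow_neg_one]
    calc (∑' m, a m * b (l - m)) ^ p * W l ^ p ≤ (S ^ (1 / p) * (W l)⁻¹) ^ p * W l ^ p := by
          gcongr
      _ = S := by
          rw [← ENNReal.mul_rpow_of_nonneg _ _ hp.le, mul_assoc,
            ENNReal.inv_mul_cancel (hW0 _) (hWt _), mul_one, ← ENNReal.rpow_mul,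
            one_div_mul_cancel hp.ne', ENNReal.rpow_one]

end Convolution

end WeightedNorms

/-! ### Consequences of the GRS condition -/

section Weights

variable {d : ℕ} {ν : (Fin d → ℤ) → ℝ≥0}

/-- If `ν 0 = 0`, the GRS limit at `x = 0` would be `0`. So `ν 0 ≤ (ν 0)²` gives `1 ≤ ν 0`, and
symmetry gives `ν 0 ≤ (ν x)²`. -/
theorem IsAdmissible.one_le (hν : IsAdmissible ν) (x : Fin d → ℤ) : 1 ≤ ν x := by
  have h0 : ν 0 ≠ 0 := by
    intro h
    have h1 := hν.grs 0
    have h2 : Tendsto (fun n : ℕ => ν (n • (0 : Fin d → ℤ)) ^ (1 / (n : ℝ))) atTop (𝓝 0) := by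
      refine tendsto_const_nhds.congr' ?_
      filter_upwards [eventually_gt_atTop 0] with n hn
      have : (0 : ℝ) < n := by exact_mod_cast hn
      rw [smul_zero, h, NNReal.zero_rpow (by positivity)]
    exact zero_ne_one (tendsto_nhds_unique h2 h1)
  have h1 : 1 ≤ ν 0 := by
    have := hν.submul 0 0
    rw [add_zero] at this
    exact le_of_mul_le_mul_right (by rwa [one_mul]) (pos_iff_ne_zero.2 h0)
  have h2 := hν.submul x (-x)
  rw [add_neg_cancel, hν.symm] at h2
  by_contra! h3
  exact absurd (h1.trans h2) (not_le.2 (mul_lt_one_of_nonneg_of_lt_one_left zero_le h3 h3.le))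

theorem IsAdmissible.exists_nsmul_le (hν : IsAdmissible ν) (x : Fin d → ℤ) {q : ℝ≥0}
    (hq : 1 < q) : ∃ C : ℝ≥0, ∀ n : ℕ, ν (n • x) ≤ C * q ^ n := by
  obtain ⟨n₀, hn₀⟩ := eventually_atTop.1 ((hν.grs x).eventually (gt_mem_nhds hq))
  -- The sum absorbs the finitely many `n` before the GRS bound takes effect; the `1` makes the
  -- constant admissible afterwards.
  refine ⟨1 + ∑ n ∈ Finset.range (n₀ + 1), ν (n • x), fun n => ?_⟩
  rcases le_or_gt n n₀ with h | h
  · calc ν (n • x) ≤ ∑ n ∈ Finset.range (n₀ + 1), ν (n • x) :=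
        Finset.single_le_sum (f := fun n : ℕ => ν (n • x)) (fun _ _ => zero_le)
          (Finset.mem_range.2 (by omega))
      _ ≤ 1 + ∑ n ∈ Finset.range (n₀ + 1), ν (n • x) := le_add_self
      _ ≤ _ := le_mul_of_one_le_right zero_le (one_le_pow₀ hq.le)
  · have hn : (0 : ℝ) < n := by exact_mod_cast (by omega : 0 < n)
    have h1 : ν (n • x) ≤ q ^ n := by
      have := (hn₀ n h.le).le
      rw [one_div, NNReal.rpow_inv_le_iff hn, NNReal.rpow_natCast] at this
      exact this
    exact h1.trans (le_mul_of_one_le_left zero_le le_self_add)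

/-- The exponential weight `q^{|l₁| + ⋯ + |l_d|}`. -/
def expWeight (q : ℝ≥0) (l : Fin d → ℤ) : ℝ≥0 := ∏ i, q ^ (l i).natAbs

theorem one_le_expWeight {q : ℝ≥0} (hq : 1 ≤ q) (l : Fin d → ℤ) : 1 ≤ expWeight q l :=
  Finset.one_le_prod' fun _ _ => one_le_pow₀ hq

theorem expWeight_add_le {q : ℝ≥0} (hq : 1 ≤ q) (x y : Fin d → ℤ) :
    expWeight q (x + y) ≤ expWeight q x * expWeight q y := by
  unfold expWeight
  rw [← Finset.prod_mul_distrib]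
  refine Finset.prod_le_prod' fun i _ => ?_
  rw [← pow_add]
  exact pow_le_pow_right₀ hq (Int.natAbs_add_le _ _)

/-- Decompose `l` along the coordinate axes and use submultiplicativity; symmetry of `ν` handles
negative coordinates. Thus GRS, a condition along single rays, yields a bound uniform over the
lattice. -/
theorem IsAdmissible.exists_le_expWeight (hν : IsAdmissible ν) {q : ℝ≥0} (hq : 1 < q) :
    ∃ C : ℝ≥0, ∀ l, ν l ≤ C * expWeight q l := by
  choose C hC using fun i : Fin d => hν.exists_nsmul_le (Pi.single i 1) hq
  have h1 : ∀ (i : Fin d) (z : ℤ), ν (Pi.single i z) ≤ C i * q ^ z.natAbs := by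
    intro i z
    have h2 := hC i z.natAbs
    rw [← Pi.single_smul, nsmul_one] at h2
    rcases Int.natAbs_eq z with h | h
    · rw [← h] at h2
      exact h2
    · rw [h, Pi.single_neg, hν.symm, Int.natAbs_neg, Int.natAbs_natCast]
      exact h2
  have h2 : ∀ (s : Finset (Fin d)) (l : Fin d → ℤ),
      ν (∑ i ∈ s, Pi.single i (l i)) ≤ ν 0 * ∏ i ∈ s, (C i * q ^ (l i).natAbs) := by
    intro s l
    induction s using Finset.induction_on with
    | empty => simp
    | insert a s ha ih =>
      rw [Finset.sum_insert ha, Finset.prod_insert ha, mul_left_comm]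
      exact (hν.submul _ _).trans (mul_le_mul' (h1 _ _) ih)
  refine ⟨ν 0 * ∏ i, C i, fun l => ?_⟩
  have h3 := h2 Finset.univ l
  rwa [Finset.univ_sum_single, Finset.prod_mul_distrib, ← mul_assoc] at h3

theorem tsum_prod_apply (f : ℤ → ℝ≥0∞) :
    ∀ d : ℕ, ∑' l : Fin d → ℤ, ∏ i, f (l i) = (∑' z, f z) ^ d
  | 0 => by simp
  | d + 1 => by
    have h : ∀ c : ℤ × (Fin d → ℤ), ∏ i, f ((Fin.consEquiv fun _ : Fin (d + 1) => ℤ) c i) =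
        f c.1 * ∏ i, f (c.2 i) := fun c => by simp [Fin.consEquiv, Fin.prod_univ_succ]
    rw [← (Fin.consEquiv fun _ : Fin (d + 1) => ℤ).tsum_eq, tsum_congr h,
      ENNReal.tsum_prod (f := fun (z : ℤ) (l : Fin d → ℤ) => f z * ∏ i, f (l i)), pow_succ',
      ← tsum_prod_apply f d, ← ENNReal.tsum_mul_right]
    exact tsum_congr fun z => ENNReal.tsum_mul_left

/-- The sum factors into `d` two-sided geometric series. -/
theorem tsum_expWeight_rpow_neg_lt_top {q : ℝ≥0} (hq : 1 < q) {p : ℝ} (hp : 0 < p) :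
    ∑' l : Fin d → ℤ, (expWeight q l : ℝ≥0∞) ^ (-p) < ∞ := by
  set t : ℝ≥0∞ := (q : ℝ≥0∞) ^ (-p) with ht
  have ht1 : t < 1 := by
    rw [ht, ENNReal.rpow_neg]
    exact ENNReal.inv_lt_one.2 (ENNReal.one_lt_rpow (by exact_mod_cast hq) hp)
  have h1 : ∀ l : Fin d → ℤ, (expWeight q l : ℝ≥0∞) ^ (-p) = ∏ i, t ^ (l i).natAbs := by
    intro l
    rw [expWeight, ENNReal.ofNNReal_finsetProd, ← ENNReal.prod_rpow_of_ne_top (by simp)]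
    refine Finset.prod_congr rfl fun i _ => ?_
    rw [ht, ENNReal.coe_pow, ← ENNReal.rpow_natCast, ← ENNReal.rpow_natCast, ← ENNReal.rpow_mul,
      ← ENNReal.rpow_mul, mul_comm]
  simp only [h1]
  rw [tsum_prod_apply (fun z => t ^ z.natAbs)]
  refine ENNReal.pow_lt_top ?_
  have h2 : HasSum (fun z : ℤ => t ^ z.natAbs) (∑' n : ℕ, t ^ n + ∑' n : ℕ, t ^ (n + 1)) := by
    refine HasSum.of_nat_of_neg_add_one ?_ ?_
    · simpa only [Int.natAbs_natCast] using ENNReal.summable.hasSum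
    · have : ∀ n : ℕ, (-((n : ℤ) + 1)).natAbs = n + 1 := by intro n; omega
      simpa only [this] using ENNReal.summable.hasSum
  have h3 : ∑' n : ℕ, t ^ n < ∞ := by
    rw [ENNReal.tsum_geometric]
    exact ENNReal.inv_lt_top.2 (tsub_pos_of_lt ht1)
  rw [h2.tsum_eq]
  refine ENNReal.add_lt_top.2 ⟨h3, ?_⟩
  refine lt_of_le_of_lt ?_ h3
  exact ENNReal.tsum_comp_le_tsum_of_injective (add_left_injective 1) (fun n : ℕ => t ^ n)

end Weights

/-! ### Summability of convolution powers -/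

section Powers

variable {d : ℕ} {ν : (Fin d → ℤ) → ℝ≥0} {p : ℝ}

theorem seqNorm_finset_sum_le {G ι : Type*} [AddCommGroup G] {μ : G → ℝ≥0} (hp : 0 < p)
    (s : Finset ι) (f : ι → ConvSeq G) :
    seqNorm p μ (∑ i ∈ s, f i).toFun ≤ ∑ i ∈ s, seqNorm p μ (f i) := by
  classical
  induction s using Finset.induction_on with
  | empty => exact (seqNorm_zero hp).le
  | insert a s ha ih =>
    rw [Finset.sum_insert ha, Finset.sum_insert ha]
    exact (seqNorm_add_le hp _ _).trans (by gcongr)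

/-- Handles the binomial coefficients in `add_pow`, which are natural numbers of the convolution
semiring. -/
theorem seqNorm_mul_natCast_le {G : Type*} [AddCommGroup G] {μ : G → ℝ≥0} (hp : 0 < p)
    (a : ConvSeq G) (n : ℕ) :
    seqNorm p μ (a * (n : ConvSeq G)).toFun ≤ seqNorm p μ a * n := by
  induction n with
  | zero =>
    rw [Nat.cast_zero, mul_zero, Nat.cast_zero, mul_zero]
    exact (seqNorm_zero hp).le
  | succ n ih =>
    rw [Nat.cast_succ, Nat.cast_succ, mul_add, mul_add, mul_one, mul_one]
    exact (seqNorm_add_le hp _ _).trans (by gcongr)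

/-- Powers of a finitely supported sequence: the weight does not change the growth rate. -/
theorem exists_seqNorm_pow_le (hp : 0 < p) (hν : IsAdmissible ν) (b : ConvSeq (Fin d → ℤ))
    (s : Finset (Fin d → ℤ)) (hs : ∀ l ∉ s, b l = 0) {ρ : ℝ≥0∞} (hb : ∑' l, b l < ρ) :
    ∃ C : ℝ≥0∞, C < ∞ ∧ ∀ n : ℕ, seqNorm p ν (b ^ n).toFun ≤ C * (ρ ^ min p 1) ^ n := by
  have hbt : ∀ l, b l ≠ ∞ := fun l => ((ENNReal.le_tsum l).trans_lt (hb.trans_le le_top)).ne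
  -- At `q = 1` the finite sum is at most `‖b‖₁ < ρ`, so by continuity some `q > 1` still works. The
  -- weight is squared to leave room: one factor absorbs `ν`, the other provides `p`-summability.
  have h1 : ∀ᶠ q : ℝ≥0 in 𝓝 1, ∑ l ∈ s, b l * ((expWeight q l ^ 2 : ℝ≥0) : ℝ≥0∞) < ρ := by
    have hc : Continuous fun q : ℝ≥0 =>
        ∑ l ∈ s, b l * ((expWeight q l ^ 2 : ℝ≥0) : ℝ≥0∞) := by
      refine continuous_finsetSum _ fun l _ => ?_
      refine (ENNReal.continuous_const_mul (hbt l)).comp (ENNReal.continuous_coe.comp ?_)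
      unfold expWeight
      fun_prop
    refine hc.continuousAt.eventually (gt_mem_nhds ?_)
    simp only [expWeight, one_pow, Finset.prod_const_one, ENNReal.coe_one, mul_one]
    exact (ENNReal.sum_le_tsum s).trans_lt hb
  obtain ⟨q, hqρ, hq⟩ : ∃ q : ℝ≥0, ∑ l ∈ s, b l * ((expWeight q l ^ 2 : ℝ≥0) : ℝ≥0∞) < ρ ∧ 1 < q :=
    ((h1.filter_mono nhdsWithin_le_nhds).and
      (self_mem_nhdsWithin (s := Set.Ioi (1 : ℝ≥0)))).exists
  obtain ⟨C, hC⟩ := hν.exists_le_expWeight hq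
  set w : (Fin d → ℤ) → ℝ≥0∞ := fun l => (expWeight q l : ℝ≥0∞) with hw
  have hw1 : ∀ l, 1 ≤ w l := fun l => by
    simp only [hw]
    exact_mod_cast one_le_expWeight hq.le l
  have hw0 : ∀ l, w l ≠ 0 := fun l => (zero_lt_one.trans_le (hw1 l)).ne'
  have hwt : ∀ l, w l ≠ ∞ := fun l => ENNReal.coe_ne_top
  have hbw : ∑' l, b l * w l ^ 2 < ρ := by
    rw [tsum_eq_sum (s := s) (fun l hl => by rw [hs l hl, zero_mul])]
    simpa only [ENNReal.coe_pow] using hqρ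
  have hpow : ∀ n l, (b ^ n) l ≤ ρ ^ n * (w l ^ 2)⁻¹ := by
    intro n l
    have h2 : ∑' l, (b ^ n) l * w l ^ 2 ≤ ρ ^ n := by
      refine (ConvSeq.tsum_pow_weight_le (w := fun l => w l ^ 2) ?_ ?_ b n).trans
        (pow_le_pow_left₀ zero_le hbw.le n)
      · intro x y
        rw [← mul_pow]
        refine pow_le_pow_left₀ zero_le ?_ 2
        simp only [hw]
        exact_mod_cast expWeight_add_le hq.le x y
      · simp [hw, expWeight]
    rw [← div_eq_mul_inv, ENNReal.le_div_iff_mul_le (Or.inl (pow_ne_zero 2 (hw0 l)))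
      (Or.inl (ENNReal.pow_ne_top (hwt l)))]
    exact (ENNReal.le_tsum (f := fun l => (b ^ n) l * w l ^ 2) l).trans h2
  refine ⟨seqNorm p ν (fun l => (w l ^ 2)⁻¹), ?_, fun n => ?_⟩
  · rw [seqNorm_lt_top_iff hp]
    have h3 : weightedSum p ν (fun l => (w l ^ 2)⁻¹) ≤ (C : ℝ≥0∞) ^ p * ∑' l, w l ^ (-p) := by
      rw [← ENNReal.tsum_mul_left]
      refine ENNReal.tsum_le_tsum fun l => ?_
      have h4 : (ν l : ℝ≥0∞) ≤ C * w l := by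
        simp only [hw]
        exact_mod_cast hC l
      calc ((w l ^ 2)⁻¹) ^ p * (ν l : ℝ≥0∞) ^ p ≤ ((w l ^ 2)⁻¹) ^ p * (C * w l) ^ p := by gcongr
        _ = (C * (w l)⁻¹) ^ p := by
            rw [← ENNReal.mul_rpow_of_nonneg _ _ hp.le]
            congr 1
            rw [sq, ENNReal.mul_inv (Or.inl (hw0 l)) (Or.inl (hwt l))]
            calc (w l)⁻¹ * (w l)⁻¹ * (C * w l) = C * (w l)⁻¹ * ((w l)⁻¹ * w l) := by ring
              _ = _ := by rw [ENNReal.inv_mul_cancel (hw0 l) (hwt l), mul_one]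
        _ = _ := by
            rw [ENNReal.mul_rpow_of_nonneg _ _ hp.le, ENNReal.inv_rpow, ENNReal.rpow_neg]
    refine h3.trans_lt (ENNReal.mul_lt_top ?_ ?_)
    · exact ENNReal.rpow_lt_top_of_nonneg hp.le ENNReal.coe_ne_top
    · exact tsum_expWeight_rpow_neg_lt_top hq hp
  · refine (seqNorm_mono hp (hpow n)).trans ?_
    rw [seqNorm_const_mul hp, mul_comm]
    gcongr
    rw [← ENNReal.rpow_natCast, ← ENNReal.rpow_mul, mul_comm, ENNReal.rpow_mul,
      ENNReal.rpow_natCast]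

/-- The spectral radius of a nonnegative sequence in the weighted convolution algebra is at most
its `ℓ¹`-norm. -/
theorem tsum_seqNorm_pow_lt_top (hp : 0 < p) (hν : IsAdmissible ν)
    (hpν : 1 < p → IsPAlgebraWeight p ν) (a : ConvSeq (Fin d → ℤ)) (ha : seqNorm p ν a < ∞)
    (ha1 : ∑' l, a l < 1) : ∑' n : ℕ, seqNorm p ν (a ^ n).toFun < ∞ := by
  obtain ⟨ρ, hρ, hρ1⟩ := exists_between ha1
  have hr : 0 < min p 1 := lt_min hp one_pos
  have hσ : ρ ^ min p 1 < 1 := ENNReal.rpow_lt_one hρ1 hr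
  -- The rate `τ < 1` is split as `ρ ^ r + (τ - ρ ^ r)` with `r = min p 1`: the first is the growth
  -- rate for the finitely supported part `b`, the second bounds the norm of the tail `c`. The
  -- binomial theorem recombines them.
  obtain ⟨τ, hτ, hτ1⟩ := exists_between hσ
  obtain ⟨s, hs⟩ := exists_finset_seqNorm_indicator_compl_lt hp ha (tsub_pos_of_lt hτ)
  set b : ConvSeq (Fin d → ℤ) := ⟨(s : Set (Fin d → ℤ)).indicator a⟩ with hb
  set c : ConvSeq (Fin d → ℤ) := ⟨(s : Set (Fin d → ℤ))ᶜ.indicator a⟩ with hc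
  have habc : a = b + c := by
    ext l
    exact (Set.indicator_self_add_compl_apply _ _ _).symm
  obtain ⟨C, hC, hCb⟩ := exists_seqNorm_pow_le (p := p) hp hν b s
    (fun l hl => Set.indicator_of_notMem (by simpa using hl) _)
    (lt_of_le_of_lt (ENNReal.tsum_le_tsum fun l => Set.indicator_le_self' (by simp) l) hρ)
  have hmul : ∀ (x : ConvSeq (Fin d → ℤ)) (k : ℕ),
      seqNorm p ν (x * c ^ k).toFun ≤ seqNorm p ν x * (τ - ρ ^ min p 1) ^ k := by
    intro x k
    induction k with
    | zero => simp
    | succ k ih =>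
      rw [pow_succ, pow_succ, ← mul_assoc, ← mul_assoc]
      exact (seqNorm_mul_le hp hν.one_le hν.submul hpν _ _).trans (mul_le_mul' ih hs.le)
  have hn : ∀ n : ℕ, seqNorm p ν (a ^ n).toFun ≤ C * τ ^ n := by
    intro n
    rw [habc, add_pow]
    refine (seqNorm_finset_sum_le hp _ _).trans ?_
    calc _ ≤ ∑ m ∈ Finset.range (n + 1),
          C * (ρ ^ min p 1) ^ m * (τ - ρ ^ min p 1) ^ (n - m) * (n.choose m : ℝ≥0∞) := by
          refine Finset.sum_le_sum fun m _ => (seqNorm_mul_natCast_le hp _ _).trans ?_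
          gcongr
          exact (hmul _ _).trans (by gcongr; exact hCb m)
      _ = C * τ ^ n := by
          nth_rewrite 2 [← add_tsub_cancel_of_le hτ.le]
          rw [add_pow, Finset.mul_sum]
          exact Finset.sum_congr rfl fun m _ => by ring
  refine (ENNReal.tsum_le_tsum hn).trans_lt ?_
  rw [ENNReal.tsum_mul_left, ENNReal.tsum_geometric]
  exact ENNReal.mul_lt_top hC (ENNReal.inv_lt_top.2 (tsub_pos_of_lt hτ1))

end Powers

/-! ### Operators, their side diagonals, and domination by convolution -/

section Operators

variable {d : ℕ} {H : Type*} [NormedAddCommGroup H] [InnerProductSpace ℂ H]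

/-- The sequence of the suprema of the norms along the side diagonals of a matrix. -/
def diagSup (A : OpMatrix d H) : ConvSeq (Fin d → ℤ) := ⟨fun l => ⨆ k, ‖A k (k - l)‖ₑ⟩

theorem diagSup_apply (A : OpMatrix d H) (l : Fin d → ℤ) :
    diagSup A l = ⨆ k, ‖A k (k - l)‖ₑ := rfl

theorem enorm_le_diagSup (A : OpMatrix d H) (k l : Fin d → ℤ) :
    ‖A k (k - l)‖ₑ ≤ diagSup A l :=
  le_iSup (fun k => ‖A k (k - l)‖ₑ) k

theorem bgsSum_eq_weightedSum (p : ℝ) (ν : (Fin d → ℤ) → ℝ≥0) (A : OpMatrix d H) :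
    bgsSum p ν A = weightedSum p ν (diagSup A) := rfl

theorem mem_bgsClass_iff {p : ℝ} (hp : 0 < p) (ν : (Fin d → ℤ) → ℝ≥0) (A : OpMatrix d H) :
    A ∈ bgsClass d H p ν ↔ seqNorm p ν (diagSup A) < ∞ :=
  (seqNorm_lt_top_iff hp _).symm

theorem bgsNorm_eq_toReal_seqNorm (p : ℝ) (ν : (Fin d → ℤ) → ℝ≥0) (A : OpMatrix d H) :
    bgsNorm p ν A = (seqNorm p ν (diagSup A)).toReal := by
  unfold bgsNorm seqNorm
  rw [bgsSum_eq_weightedSum]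
  split_ifs
  · rfl
  · rw [ENNReal.toReal_rpow]

/-! ### Elementary properties of the canonical matrix -/

theorem canonicalMatrix_apply (T : L2 d H →L[ℂ] L2 d H) (k l : Fin d → ℤ) (v : H) :
    canonicalMatrix T k l v = T (lp.single 2 l v) k := rfl

theorem canonicalMatrix_injective :
    Function.Injective (canonicalMatrix : (L2 d H →L[ℂ] L2 d H) → OpMatrix d H) := by
  intro S T h
  ext x : 1
  refine lp.ext (funext fun k => ?_)
  exact ((canonicalMatrix_eq_iff S _).1 h x k).unique ((canonicalMatrix_eq_iff T _).1 rfl x k)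

theorem canonicalMatrix_add (S T : L2 d H →L[ℂ] L2 d H) :
    canonicalMatrix (S + T) = canonicalMatrix S + canonicalMatrix T := rfl

theorem canonicalMatrix_sub (S T : L2 d H →L[ℂ] L2 d H) :
    canonicalMatrix (S - T) = canonicalMatrix S - canonicalMatrix T := by
  funext k l
  ext v
  simp [canonicalMatrix_apply]

theorem canonicalMatrix_smul (c : ℂ) (T : L2 d H →L[ℂ] L2 d H) :
    canonicalMatrix (c • T) = c • canonicalMatrix T := rfl

theorem canonicalMatrix_one_apply (k l : Fin d → ℤ) :
    canonicalMatrix (1 : L2 d H →L[ℂ] L2 d H) k l = if k = l then 1 else 0 := by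
  ext v
  rw [canonicalMatrix_apply]
  split_ifs with h
  · subst h
    simp
  · simpa using lp.single_apply_ne (E := fun _ : Fin d → ℤ => H) 2 l v h

theorem continuous_canonicalMatrix_apply (k l : Fin d → ℤ) :
    Continuous fun T : L2 d H →L[ℂ] L2 d H => canonicalMatrix T k l := by
  unfold canonicalMatrix
  fun_prop

/-- Each matrix entry is continuous in the operator norm, and suprema and sums of nonnegative terms
preserve lower semicontinuity, as in Fatou's lemma. -/
theorem lowerSemicontinuous_weightedSum {p : ℝ} (hp : 0 < p) (ν : (Fin d → ℤ) → ℝ≥0) :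
    LowerSemicontinuous fun T : L2 d H →L[ℂ] L2 d H =>
      weightedSum p ν (diagSup (canonicalMatrix T)) := by
  refine lowerSemicontinuous_tsum fun l => ?_
  have h1 : LowerSemicontinuous fun T : L2 d H →L[ℂ] L2 d H => diagSup (canonicalMatrix T) l :=
    lowerSemicontinuous_iSup fun k =>
      (continuous_enorm.comp (continuous_canonicalMatrix_apply k (k - l))).lowerSemicontinuous
  have h2 : Continuous fun t : ℝ≥0∞ => t ^ p * (ν l : ℝ≥0∞) ^ p :=
    (ENNReal.continuous_mul_const (ENNReal.rpow_ne_top_of_nonneg hp.le ENNReal.coe_ne_top)).comp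
      ENNReal.continuous_rpow_const
  exact h2.comp_lowerSemicontinuous h1 fun s t hst => by dsimp only; gcongr

/-- Balls of the class are closed for the operator norm. -/
theorem seqNorm_le_of_tendsto {p : ℝ} (hp : 0 < p) (ν : (Fin d → ℤ) → ℝ≥0) {ι : Type*}
    {f : Filter ι} [f.NeBot] {u : ι → L2 d H →L[ℂ] L2 d H} {T : L2 d H →L[ℂ] L2 d H}
    (hu : Tendsto u f (𝓝 T)) {c : ℝ≥0∞}
    (h : ∀ᶠ i in f, seqNorm p ν (diagSup (canonicalMatrix (u i))) ≤ c) :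
    seqNorm p ν (diagSup (canonicalMatrix T)) ≤ c := by
  obtain ⟨c', hc'⟩ := exists_seqNorm_le_iff_weightedSum_le hp ν c
  rw [hc']
  refine ((lowerSemicontinuous_weightedSum hp ν).isClosed_preimage c').mem_of_tendsto hu ?_
  filter_upwards [h] with i hi
  exact (hc' _).1 hi

/-! ### Diagonal suprema and the algebraic operations -/

theorem diagSup_add_le (A B : OpMatrix d H) (l : Fin d → ℤ) :
    diagSup (A + B) l ≤ diagSup A l + diagSup B l :=
  iSup_le fun k => (enorm_add_le (A k (k - l)) (B k (k - l))).trans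
    (add_le_add (enorm_le_diagSup A k l) (enorm_le_diagSup B k l))

theorem diagSup_smul (c : ℂ) (A : OpMatrix d H) (l : Fin d → ℤ) :
    diagSup (c • A) l = ‖c‖ₑ * diagSup A l := by
  rw [diagSup_apply, diagSup_apply, ENNReal.mul_iSup]
  exact iSup_congr fun k => enorm_smul c (A k (k - l))

/-- Only an inequality, since the identity of `H` has norm `0` when `H` is trivial. -/
theorem diagSup_one_le (l : Fin d → ℤ) :
    diagSup (canonicalMatrix (1 : L2 d H →L[ℂ] L2 d H)) l ≤ (1 : ConvSeq (Fin d → ℤ)) l := by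
  refine iSup_le fun k => ?_
  rw [canonicalMatrix_one_apply, ConvSeq.one_apply]
  by_cases hl : l = 0
  · simp only [hl, sub_zero, if_true]
    refine ContinuousLinearMap.opENorm_le_bound _ fun v => ?_
    simp
  · have : k ≠ k - l := fun h => hl (by simpa using h.symm)
    rw [if_neg this, if_neg hl]
    exact (enorm_zero (E := H →L[ℂ] H)).le

/-- With the summation index written as `k - m`, the entry `(k, k - m)` lies on diagonal `m` and `(k
- m, k - l)` on diagonal `l - m`, which is the convolution pattern. -/
theorem diagSup_mul_le (S T : L2 d H →L[ℂ] L2 d H) (l : Fin d → ℤ) :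
    diagSup (canonicalMatrix (S * T)) l ≤
      (diagSup (canonicalMatrix S) * diagSup (canonicalMatrix T)) l := by
  refine iSup_le fun k => ContinuousLinearMap.opENorm_le_bound _ fun v => ?_
  have h := hasSum_canonicalMatrix_mul S T k (k - l) v
  rw [← h.tsum_eq, ConvSeq.mul_apply, ← ENNReal.tsum_mul_right, ← (Equiv.subLeft k).tsum_eq]
  refine enorm_tsum_le_tsum_enorm.trans (ENNReal.tsum_le_tsum fun m => ?_)
  simp only [Equiv.subLeft_apply]
  have h1 : canonicalMatrix T (k - m) (k - l) = canonicalMatrix T (k - m) (k - m - (l - m)) := by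
    congr 1
    abel
  rw [h1, mul_assoc]
  refine (ContinuousLinearMap.le_opENorm _ _).trans
    (mul_le_mul' (enorm_le_diagSup _ _ _) ?_)
  exact (ContinuousLinearMap.le_opENorm _ _).trans
    (mul_le_mul' (enorm_le_diagSup _ _ _) le_rfl)

theorem diagSup_pow_le (T : L2 d H →L[ℂ] L2 d H) (n : ℕ) (l : Fin d → ℤ) :
    diagSup (canonicalMatrix (T ^ n)) l ≤ (diagSup (canonicalMatrix T) ^ n) l := by
  induction n generalizing l with
  | zero => exact diagSup_one_le l
  | succ n ih =>
    rw [pow_succ, pow_succ]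
    exact (diagSup_mul_le _ _ l).trans (ConvSeq.mul_le_mul_apply ih (fun _ => le_rfl) l)

theorem diagSup_star [CompleteSpace H] (T : L2 d H →L[ℂ] L2 d H) (l : Fin d → ℤ) :
    diagSup (canonicalMatrix (star T)) l = diagSup (canonicalMatrix T) (-l) := by
  rw [diagSup_apply, diagSup_apply, ← (Equiv.addRight l).iSup_comp]
  refine iSup_congr fun k => ?_
  rw [canonicalMatrix_star]
  simp only [Equiv.coe_addRight, add_sub_cancel_right, sub_neg_eq_add]
  rw [← ofReal_norm, norm_star, ofReal_norm]

/-! ### Operators defined by matrices with summable diagonals -/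

omit [InnerProductSpace ℂ H] in
-- Serves both the diagonal operators (shift `m`) and multiplication by tents (shift `0`).
theorem memℓp_of_norm_le_shift {x : (Fin d → ℤ) → H} {y : L2 d H} {c : ℝ} {m : Fin d → ℤ}
    (h : ∀ k, ‖x k‖ ≤ c * ‖y (k - m)‖) : Memℓp x 2 := by
  have hy : Summable fun k => ‖y k‖ ^ (2 : ℝ≥0∞).toReal :=
    (memℓp_gen_iff (by simp)).1 (lp.memℓp y)
  have hy' : Summable fun k => c ^ 2 * ‖y (k - m)‖ ^ 2 := by
    refine Summable.mul_left _ ?_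
    simp only [ENNReal.toReal_ofNat, Real.rpow_ofNat] at hy
    exact (Equiv.subRight m).summable_iff.2 hy
  refine memℓp_gen ?_
  simp only [ENNReal.toReal_ofNat, Real.rpow_ofNat]
  refine hy'.of_nonneg_of_le (fun k => by positivity) fun k => ?_
  rw [← mul_pow]
  exact pow_le_pow_left₀ (norm_nonneg _) (h k) 2

omit [InnerProductSpace ℂ H] in
theorem norm_le_of_norm_le_shift {x y : L2 d H} {c : ℝ} (hc : 0 ≤ c) {m : Fin d → ℤ}
    (h : ∀ k, ‖x k‖ ≤ c * ‖y (k - m)‖) : ‖x‖ ≤ c * ‖y‖ := by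
  have h2 : ∀ z : L2 d H, ‖z‖ ^ 2 = ∑' k, ‖z k‖ ^ 2 := fun z => by
    simpa using lp.norm_rpow_eq_tsum (p := 2) (by simp) z
  have hs : ∀ z : L2 d H, Summable fun k => ‖z k‖ ^ 2 := fun z => by
    simpa using (memℓp_gen_iff (by simp)).1 (lp.memℓp z)
  have e : ∑' k, ‖y k‖ ^ 2 = ∑' k, ‖y (k - m)‖ ^ 2 :=
    ((Equiv.subRight m).tsum_eq fun k => ‖y k‖ ^ 2).symm
  have hs' : Summable fun k => ‖y (k - m)‖ ^ 2 := (Equiv.subRight m).summable_iff.2 (hs y)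
  refine abs_le_of_sq_le_sq' ?_ (by positivity) |>.2
  rw [mul_pow, h2, h2, e, ← tsum_mul_left]
  refine (hs x).tsum_le_tsum (fun k => ?_) (hs'.mul_left _)
  rw [← mul_pow]
  exact pow_le_pow_left₀ (norm_nonneg _) (h k) 2

theorem norm_apply_le_diagSup {A : OpMatrix d H} {m : Fin d → ℤ} (hA : diagSup A m ≠ ∞)
    (x : L2 d H) (k : Fin d → ℤ) :
    ‖A k (k - m) (x (k - m))‖ ≤ (diagSup A m).toReal * ‖x (k - m)‖ := by
  refine (A k (k - m)).le_of_opNorm_le ?_ _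
  rw [← toReal_enorm]
  exact ENNReal.toReal_mono hA (enorm_le_diagSup A k m)

/-- The operator given by the `m`-th side diagonal of a matrix. -/
def diagOp (A : OpMatrix d H) (hA : ∀ m, diagSup A m ≠ ∞) (m : Fin d → ℤ) :
    L2 d H →L[ℂ] L2 d H :=
  LinearMap.mkContinuous
    { toFun := fun x => ⟨fun k => A k (k - m) (x (k - m)),
        memℓp_of_norm_le_shift (norm_apply_le_diagSup (hA m) x)⟩
      map_add' := fun _ _ => lp.ext (funext fun k => map_add (A k (k - m)) _ _)
      map_smul' := fun _ _ => lp.ext (funext fun k => map_smul (A k (k - m)) _ _) }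
    (diagSup A m).toReal
    fun x => norm_le_of_norm_le_shift ENNReal.toReal_nonneg (norm_apply_le_diagSup (hA m) x)

theorem diagOp_apply (A : OpMatrix d H) (hA : ∀ m, diagSup A m ≠ ∞) (m k : Fin d → ℤ)
    (x : L2 d H) : diagOp A hA m x k = A k (k - m) (x (k - m)) := rfl

theorem enorm_diagOp_le (A : OpMatrix d H) (hA : ∀ m, diagSup A m ≠ ∞) (m : Fin d → ℤ) :
    ‖diagOp A hA m‖ₑ ≤ diagSup A m := by
  rw [← ofReal_norm]
  refine ENNReal.ofReal_le_of_le_toReal (ContinuousLinearMap.opNorm_le_bound _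
    ENNReal.toReal_nonneg fun x => ?_)
  exact norm_le_of_norm_le_shift ENNReal.toReal_nonneg (norm_apply_le_diagSup (hA m) x)

theorem diagSup_ne_top {A : OpMatrix d H} (hA : ∑' l, diagSup A l ≠ ∞) (l : Fin d → ℤ) :
    diagSup A l ≠ ∞ :=
  ne_top_of_le_ne_top hA (ENNReal.le_tsum l)

variable [CompleteSpace H]

theorem summable_diagOp (A : OpMatrix d H) (hA : ∑' l, diagSup A l ≠ ∞) :
    Summable fun m => diagOp A (diagSup_ne_top hA) m := by
  refine Summable.of_enorm ?_
  exact ne_top_of_le_ne_top hA (ENNReal.tsum_le_tsum fun m => enorm_diagOp_le A _ m)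

/-- The operator defined by a matrix with summable diagonals. -/
def matrixOp (A : OpMatrix d H) (hA : ∑' l, diagSup A l ≠ ∞) : L2 d H →L[ℂ] L2 d H :=
  ∑' m, diagOp A (diagSup_ne_top hA) m

theorem hasSum_matrixOp_apply (A : OpMatrix d H) (hA : ∑' l, diagSup A l ≠ ∞) (x : L2 d H)
    (k : Fin d → ℤ) : HasSum (fun l => A k l (x l)) (matrixOp A hA x k) := by
  have h1 := ((summable_diagOp A hA).hasSum.mapL (ContinuousLinearMap.apply ℂ (L2 d H) x)).mapL
    (coord k)
  rw [← (Equiv.subLeft k).hasSum_iff]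
  exact h1

theorem canonicalMatrix_matrixOp (A : OpMatrix d H) (hA : ∑' l, diagSup A l ≠ ∞) :
    canonicalMatrix (matrixOp A hA) = A :=
  (canonicalMatrix_eq_iff _ _).2 (hasSum_matrixOp_apply A hA)

/-- An operator with summable diagonals is the sum of its diagonals. -/
theorem hasSum_diagOp (T : L2 d H →L[ℂ] L2 d H)
    (hT : ∑' l, diagSup (canonicalMatrix T) l ≠ ∞) :
    HasSum (fun m => diagOp (canonicalMatrix T) (diagSup_ne_top hT) m) T := by
  have h := (summable_diagOp _ hT).hasSum
  rwa [show ∑' m, diagOp (canonicalMatrix T) (diagSup_ne_top hT) m = T from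
    canonicalMatrix_injective (canonicalMatrix_matrixOp _ hT)] at h

theorem enorm_le_tsum_diagSup (T : L2 d H →L[ℂ] L2 d H) :
    ‖T‖ₑ ≤ ∑' l, diagSup (canonicalMatrix T) l := by
  by_cases hT : ∑' l, diagSup (canonicalMatrix T) l = ∞
  · rw [hT]
    exact le_top
  · calc ‖T‖ₑ = ‖∑' m, diagOp (canonicalMatrix T) (diagSup_ne_top hT) m‖ₑ := by
          rw [(hasSum_diagOp T hT).tsum_eq]
      _ ≤ ∑' m, ‖diagOp (canonicalMatrix T) (diagSup_ne_top hT) m‖ₑ := enorm_tsum_le_tsum_enorm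
      _ ≤ _ := ENNReal.tsum_le_tsum fun m => enorm_diagOp_le _ _ m

end Operators

/-! ### Lattice points in balls and tent functions -/

section Lattice

variable {d : ℕ}

/-- The number of lattice points in the closed ball of radius `R`. -/
def ballCount (d : ℕ) (R : ℝ) : ℝ≥0∞ := ∑' i : Fin d → ℤ, Set.indicator {i | ‖i‖ ≤ R} 1 i

theorem finite_norm_le (d : ℕ) (R : ℝ) : {i : Fin d → ℤ | ‖i‖ ≤ R}.Finite := by
  have h := (isCompact_closedBall (0 : Fin d → ℤ) R).finite_of_discrete
  refine h.subset fun i hi => ?_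
  simpa using hi

theorem ballCount_lt_top (d : ℕ) (R : ℝ) : ballCount d R < ∞ := by
  unfold ballCount
  rw [tsum_eq_sum (s := (finite_norm_le d R).toFinset)
    (fun i hi => Set.indicator_of_notMem (by simpa using hi) _)]
  refine ENNReal.sum_lt_top.2 fun i _ => ?_
  exact (Set.indicator_apply_le' (fun _ => le_rfl) fun _ => zero_le).trans_lt ENNReal.one_lt_top

theorem norm_le_of_norm_nsmul_le {N : ℕ} (hN : 0 < N) {x : Fin d → ℤ} {R : ℝ} (hR : 0 ≤ R)
    (h : ‖N • x‖ ≤ R * N) : ‖x‖ ≤ R := by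
  have hN' : (0 : ℝ) < N := by exact_mod_cast hN
  refine (pi_norm_le_iff_of_nonneg hR).2 fun i => ?_
  have h1 := (norm_le_pi_norm (N • x) i).trans h
  rw [Pi.smul_apply, nsmul_eq_mul, norm_mul, Int.norm_natCast, mul_comm] at h1
  exact le_of_mul_le_mul_right h1 hN'

/-- The index of the cube of side length `N` containing a given lattice point. -/
def cubeIndex (N : ℕ) (k : Fin d → ℤ) : Fin d → ℤ := fun i => k i / N

theorem norm_sub_nsmul_cubeIndex_le {N : ℕ} (hN : 0 < N) (k : Fin d → ℤ) :
    ‖k - N • cubeIndex N k‖ ≤ N := by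
  refine (pi_norm_le_iff_of_nonneg (Nat.cast_nonneg N)).2 fun i => ?_
  have h1 : (k - N • cubeIndex N k) i = k i % N := by
    have := Int.mul_ediv_add_emod (k i) N
    rw [Pi.sub_apply, Pi.smul_apply, nsmul_eq_mul]
    exact sub_eq_of_eq_add' this.symm
  have hN' : (0 : ℤ) < N := by exact_mod_cast hN
  have h2 := Int.emod_nonneg (k i) hN'.ne'
  have h3 := (Int.emod_lt_of_pos (k i) hN').le
  rw [h1, Int.norm_eq_abs, abs_of_nonneg (by exact_mod_cast h2)]
  exact_mod_cast h3

/-- The indices of the cubes of side length `N` near the point `m`. -/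
def nearCubes (N : ℕ) (m : Fin d → ℤ) : Set (Fin d → ℤ) := {i | ‖m - N • i‖ ≤ 3 * N}

theorem norm_cubeIndex_sub_le {N : ℕ} (hN : 0 < N) {m i : Fin d → ℤ} (hi : i ∈ nearCubes N m) :
    ‖cubeIndex N m - i‖ ≤ 4 := by
  refine norm_le_of_norm_nsmul_le hN (by norm_num) ?_
  have h1 : N • (cubeIndex N m - i) = (m - N • i) - (m - N • cubeIndex N m) := by
    rw [smul_sub]
    abel
  have h2 : ‖m - N • i‖ ≤ 3 * N := hi
  rw [h1]
  exact (norm_sub_le _ _).trans (by linarith [norm_sub_nsmul_cubeIndex_le hN m])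

theorem finite_nearCubes {N : ℕ} (hN : 0 < N) (m : Fin d → ℤ) : (nearCubes N m).Finite := by
  refine ((finite_norm_le d 4).preimage
    (sub_right_injective (b := cubeIndex N m)).injOn).subset fun i hi => ?_
  exact norm_cubeIndex_sub_le hN hi

/-- The point is that the bound depends neither on the scale `N` nor on `m`. -/
theorem tsum_indicator_nearCubes_le {N : ℕ} (hN : 0 < N) (m : Fin d → ℤ) :
    ∑' i, (nearCubes N m).indicator (1 : (Fin d → ℤ) → ℝ≥0∞) i ≤ ballCount d 4 := by
  unfold ballCount
  rw [← (Equiv.subLeft (cubeIndex N m)).tsum_eq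
    (fun i => Set.indicator {i : Fin d → ℤ | ‖i‖ ≤ 4} (1 : (Fin d → ℤ) → ℝ≥0∞) i)]
  refine ENNReal.tsum_le_tsum fun i => ?_
  by_cases hi : i ∈ nearCubes N m
  · rw [Set.indicator_of_mem hi, Set.indicator_of_mem]
    · rfl
    · exact norm_cubeIndex_sub_le hN hi
  · rw [Set.indicator_of_notMem hi]
    exact zero_le

/-- The tent function at scale `N` of the cube with index `j`. -/
def tent (N : ℕ) (j k : Fin d → ℤ) : ℝ := max 0 (min 1 (2 - ‖k - N • j‖ / N))

theorem tent_nonneg (N : ℕ) (j k : Fin d → ℤ) : 0 ≤ tent N j k := le_max_left _ _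

theorem tent_le_one (N : ℕ) (j k : Fin d → ℤ) : tent N j k ≤ 1 :=
  max_le zero_le_one (min_le_left _ _)

theorem tent_cubeIndex {N : ℕ} (hN : 0 < N) (k : Fin d → ℤ) : tent N (cubeIndex N k) k = 1 := by
  have hN' : (0 : ℝ) < N := by exact_mod_cast hN
  have h1 : ‖k - N • cubeIndex N k‖ / N ≤ 1 :=
    (div_le_one hN').2 (norm_sub_nsmul_cubeIndex_le hN k)
  unfold tent
  rw [min_eq_left (by linarith), max_eq_right zero_le_one]

theorem norm_sub_le_of_tent_ne_zero {N : ℕ} (hN : 0 < N) {j k : Fin d → ℤ}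
    (h : tent N j k ≠ 0) : ‖k - N • j‖ ≤ 2 * N := by
  have hN' : (0 : ℝ) < N := by exact_mod_cast hN
  by_contra! h1
  apply h
  have h2 : 2 < ‖k - N • j‖ / N := (lt_div_iff₀ hN').2 h1
  unfold tent
  exact max_eq_left ((min_le_right _ _).trans (by linarith))

theorem abs_tent_sub_le (N : ℕ) (j k l : Fin d → ℤ) :
    |tent N j k - tent N j l| ≤ min 1 (‖k - l‖ / N) := by
  refine le_min ?_ ?_
  · rw [abs_le]
    constructor <;> linarith [tent_nonneg N j k, tent_nonneg N j l, tent_le_one N j k,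
      tent_le_one N j l]
  · unfold tent
    rw [max_comm 0, max_comm 0]
    refine (abs_max_sub_max_le_abs _ _ _).trans ?_
    rw [min_comm 1, min_comm 1]
    refine (abs_min_sub_min_le_max _ _ _ _).trans ?_
    rw [sub_self, abs_zero, max_eq_left (abs_nonneg _), sub_sub_sub_cancel_left, ← sub_div,
      abs_div, Nat.abs_cast, abs_sub_comm]
    gcongr
    refine (abs_norm_sub_norm_le _ _).trans ?_
    rw [sub_sub_sub_cancel_right]

/-- The shifts of a tent which are relevant to its increments of step `m`. -/
def tentShifts {N : ℕ} (hN : 0 < N) (m : Fin d → ℤ) : Finset (Fin d → ℤ) :=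
  ((finite_nearCubes hN 0).union (finite_nearCubes hN m)).toFinset

/-- If the increment is nonzero, `l` or `l + m` lies in the support of the tent `j`. Then the cube
containing `l` has index `j - i` with `N • i` close to `0` or to `m`, and its tent equals `1` at
`l`, so the sum is at least `1`. -/
theorem abs_tent_add_sub_le {N : ℕ} (hN : 0 < N) (j l m : Fin d → ℤ) :
    |tent N j (l + m) - tent N j l| ≤
      min 1 (‖m‖ / N) * ∑ i ∈ tentShifts hN m, tent N (j - i) l := by
  have h0 : (0 : ℝ) ≤ min 1 (‖m‖ / N) := le_min zero_le_one (by positivity)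
  have hsum : 0 ≤ ∑ i ∈ tentShifts hN m, tent N (j - i) l :=
    Finset.sum_nonneg fun i _ => tent_nonneg _ _ _
  by_cases h : tent N j (l + m) = 0 ∧ tent N j l = 0
  · rw [h.1, h.2, sub_self, abs_zero]
    positivity
  have hmem : j - cubeIndex N l ∈ tentShifts hN m := by
    simp only [tentShifts, Set.Finite.mem_toFinset, Set.mem_union]
    have h1 := norm_sub_nsmul_cubeIndex_le hN l
    by_cases h2 : tent N j l = 0
    · right
      have h3 := norm_sub_le_of_tent_ne_zero hN (fun h3 => h ⟨h3, h2⟩)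
      have h4 : m - N • (j - cubeIndex N l) = (l + m - N • j) - (l - N • cubeIndex N l) := by
        rw [smul_sub]
        abel
      change ‖m - N • (j - cubeIndex N l)‖ ≤ 3 * N
      rw [h4]
      exact (norm_sub_le _ _).trans (by linarith)
    · left
      have h3 := norm_sub_le_of_tent_ne_zero hN h2
      have h4 : 0 - N • (j - cubeIndex N l) = (l - N • j) - (l - N • cubeIndex N l) := by
        rw [smul_sub]
        abel
      change ‖0 - N • (j - cubeIndex N l)‖ ≤ 3 * N
      rw [h4]
      exact (norm_sub_le _ _).trans (by linarith)
  have h5 : 1 ≤ ∑ i ∈ tentShifts hN m, tent N (j - i) l := by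
    refine le_trans ?_ (Finset.single_le_sum (f := fun i => tent N (j - i) l)
      (fun i _ => tent_nonneg _ _ _) hmem)
    simp only [sub_sub_cancel]
    exact (tent_cubeIndex hN l).ge
  calc |tent N j (l + m) - tent N j l| ≤ min 1 (‖l + m - l‖ / N) := abs_tent_sub_le _ _ _ _
    _ = min 1 (‖m‖ / N) * 1 := by rw [add_sub_cancel_left, mul_one]
    _ ≤ _ := by gcongr

/-- Dominated convergence; it will make the commutators small as the scale grows. -/
theorem tendsto_tsum_mul_zero {ι : Type*} {a : ι → ℝ≥0∞} (ha : ∑' i, a i ≠ ∞)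
    {κ : ℕ → ι → ℝ≥0∞} (hκ : ∀ n i, κ n i ≤ 1)
    (h : ∀ i, Tendsto (fun n => κ n i) atTop (𝓝 0)) :
    Tendsto (fun n => ∑' i, a i * κ n i) atTop (𝓝 0) := by
  let _ : MeasurableSpace ι := ⊤
  have h1 := MeasureTheory.tendsto_lintegral_of_dominated_convergence
    (μ := MeasureTheory.Measure.count) (F := fun n i => a i * κ n i) (f := fun _ => 0) a
    (fun n => measurable_from_top) (fun n => Eventually.of_forall fun i =>
      mul_le_of_le_one_right zero_le (hκ n i))
    (by rwa [MeasureTheory.lintegral_count])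
    (Eventually.of_forall fun i => by
      simpa using ENNReal.Tendsto.const_mul (h i) (Or.inr (ne_top_of_le_ne_top ha (ENNReal.le_tsum i))))
  simpa [MeasureTheory.lintegral_count] using h1

end Lattice

/-! ### Localization of operators with summable diagonals -/

section Localization

variable {d : ℕ} {H : Type*} [NormedAddCommGroup H] [InnerProductSpace ℂ H]

theorem norm_tent_smul_le (N : ℕ) (j : Fin d → ℤ) (x : L2 d H) (k : Fin d → ℤ) :
    ‖(tent N j k : ℂ) • x k‖ ≤ 1 * ‖x (k - 0)‖ := by
  rw [norm_smul, Complex.norm_real, Real.norm_of_nonneg (tent_nonneg _ _ _), sub_zero]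
  gcongr
  exact tent_le_one _ _ _

/-- Multiplication by a tent function. -/
def tentOp (N : ℕ) (j : Fin d → ℤ) : L2 d H →L[ℂ] L2 d H :=
  LinearMap.mkContinuous
    { toFun := fun x => ⟨fun k => (tent N j k : ℂ) • x k,
        memℓp_of_norm_le_shift (norm_tent_smul_le N j x)⟩
      map_add' := fun _ _ => lp.ext (funext fun _ => smul_add _ _ _)
      map_smul' := fun _ _ => lp.ext (funext fun _ => smul_comm _ _ _) }
    1 fun x => norm_le_of_norm_le_shift zero_le_one (norm_tent_smul_le N j x)

theorem tentOp_apply (N : ℕ) (j k : Fin d → ℤ) (x : L2 d H) :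
    tentOp N j x k = (tent N j k : ℂ) • x k := rfl

theorem enorm_tentOp_apply_le (N : ℕ) (j : Fin d → ℤ) (x : L2 d H) : ‖tentOp N j x‖ₑ ≤ ‖x‖ₑ := by
  rw [enorm_le_iff_norm_le, ← one_mul ‖x‖]
  exact norm_le_of_norm_le_shift zero_le_one (norm_tent_smul_le N j x)

theorem enorm_apply_le_enorm_tentOp {N : ℕ} (hN : 0 < N) (x : L2 d H) (k : Fin d → ℤ) :
    ‖x k‖ₑ ≤ ‖tentOp N (cubeIndex N k) x‖ₑ := by
  rw [enorm_le_iff_norm_le]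
  refine le_trans (le_of_eq ?_) (lp.norm_apply_le_norm two_ne_zero _ k)
  rw [tentOp_apply, tent_cubeIndex hN, Complex.ofReal_one, one_smul]

theorem enorm_tentOp_single_le {N : ℕ} (hN : 0 < N) (j m : Fin d → ℤ) (v : H) :
    ‖tentOp N j (lp.single 2 m v : L2 d H)‖ₑ ≤
      Set.indicator {j : Fin d → ℤ | ‖m - N • j‖ ≤ 2 * N} 1 j * ‖v‖ₑ := by
  by_cases h : ‖m - N • j‖ ≤ 2 * N
  · rw [Set.indicator_of_mem (by exact h), Pi.one_apply, one_mul]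
    refine (enorm_tentOp_apply_le N j _).trans (le_of_eq ?_)
    rw [← ofReal_norm, lp.norm_single (by simp), ofReal_norm]
  · have h1 : tent N j m = 0 := by
      by_contra h2
      exact h (norm_sub_le_of_tent_ne_zero hN h2)
    have h2 : tentOp N j (lp.single 2 m v : L2 d H) = 0 := by
      refine lp.ext (funext fun k => ?_)
      rw [tentOp_apply]
      by_cases hk : k = m
      · subst hk
        rw [h1, Complex.ofReal_zero, zero_smul]
        rfl
      · rw [lp.single_apply_ne _ _ _ hk, smul_zero]
        rfl
    rw [h2, enorm_zero]
    exact zero_le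

/-- The damping factor of the commutator of a tent function with the `m`-th side diagonal. -/
def damping (N : ℕ) (m : Fin d → ℤ) : ℝ := min 1 (‖m‖ / N)

theorem damping_nonneg (N : ℕ) (m : Fin d → ℤ) : 0 ≤ damping N m :=
  le_min zero_le_one (by positivity)

theorem tendsto_damping (m : Fin d → ℤ) : Tendsto (fun N => damping N m) atTop (𝓝 0) := by
  have h := (tendsto_const_nhds (x := (1 : ℝ))).min (tendsto_const_div_atTop_nhds_zero_nat ‖m‖)
  rwa [min_eq_right zero_le_one] at h

/-- At `k` the commutator is `A_{k,k-m} u_{k-m}` times a tent increment of step `m`. Bounding the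
increment by neighbouring tents keeps the estimate local in `j`. -/
theorem enorm_diagOp_commutator_le (A : OpMatrix d H) (hA : ∀ m, diagSup A m ≠ ∞) {N : ℕ}
    (hN : 0 < N) (j m : Fin d → ℤ) (u : L2 d H) :
    ‖diagOp A hA m (tentOp N j u) - tentOp N j (diagOp A hA m u)‖ₑ ≤
      diagSup A m * ENNReal.ofReal (damping N m) *
        ∑ i ∈ tentShifts hN m, ‖tentOp N (j - i) u‖ₑ := by
  set y : L2 d H := ∑ i ∈ tentShifts hN m, tentOp N (j - i) u with hy
  have hyk : ∀ k, y k = ((∑ i ∈ tentShifts hN m, tent N (j - i) k : ℝ) : ℂ) • u k := by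
    intro k
    have : y k = coord k y := rfl
    rw [this, hy, map_sum, Complex.ofReal_sum, Finset.sum_smul]
    rfl
  have hnorm : ‖diagOp A hA m (tentOp N j u) - tentOp N j (diagOp A hA m u)‖ ≤
      (diagSup A m).toReal * damping N m * ‖y‖ := by
    refine norm_le_of_norm_le_shift (m := m)
      (mul_nonneg ENNReal.toReal_nonneg (damping_nonneg N m)) fun k => ?_
    have h1 : (diagOp A hA m (tentOp N j u) - tentOp N j (diagOp A hA m u)) k =
        ((tent N j (k - m) - tent N j k : ℝ) : ℂ) • A k (k - m) (u (k - m)) := by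
      rw [lp.coeFn_sub, Pi.sub_apply, diagOp_apply, tentOp_apply, tentOp_apply, diagOp_apply,
        map_smul, ← sub_smul, Complex.ofReal_sub]
    have h2 := abs_tent_add_sub_le hN j (k - m) m
    rw [sub_add_cancel, abs_sub_comm] at h2
    rw [h1, hyk, norm_smul, norm_smul, Complex.norm_real, Complex.norm_real, Real.norm_eq_abs,
      Real.norm_of_nonneg (Finset.sum_nonneg fun i _ => tent_nonneg _ _ _)]
    calc _ ≤ (damping N m * ∑ i ∈ tentShifts hN m, tent N (j - i) (k - m)) *
          ((diagSup A m).toReal * ‖u (k - m)‖) :=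
        mul_le_mul h2 (norm_apply_le_diagSup (hA m) u k) (norm_nonneg _)
          ((abs_nonneg _).trans h2)
      _ = _ := by ring
  calc _ ≤ diagSup A m * ENNReal.ofReal (damping N m) * ‖y‖ₑ := by
        rw [← ofReal_norm, ← ofReal_norm, ← ENNReal.ofReal_toReal (hA m),
          ← ENNReal.ofReal_mul ENNReal.toReal_nonneg,
          ← ENNReal.ofReal_mul (mul_nonneg ENNReal.toReal_nonneg (damping_nonneg N m))]
        exact ENNReal.ofReal_le_ofReal hnorm
    _ ≤ _ := by
        gcongr
        exact enorm_sum_le _ _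

variable [CompleteSpace H]

/-- The sequence governing the commutators of an operator with the tent functions at scale `N`. -/
def commutatorSeq (a : ConvSeq (Fin d → ℤ)) (C : ℝ≥0∞) {N : ℕ} (hN : 0 < N) :
    ConvSeq (Fin d → ℤ) :=
  ⟨fun i => C * ∑' m, a m * ENNReal.ofReal (damping N m) *
    (tentShifts hN m : Set (Fin d → ℤ)).indicator 1 i⟩

/-- Each set `tentShifts hN m` has at most `2 * ballCount d 4` elements, uniformly in `N`, so only
the damping depends on the scale. -/
theorem tsum_commutatorSeq_le (a : ConvSeq (Fin d → ℤ)) (C : ℝ≥0∞) {N : ℕ} (hN : 0 < N) :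
    ∑' i, commutatorSeq a C hN i ≤
      C * (2 * ballCount d 4) * ∑' m, a m * ENNReal.ofReal (damping N m) := by
  simp only [commutatorSeq]
  rw [ENNReal.tsum_mul_left, ENNReal.tsum_comm, mul_assoc]
  refine mul_le_mul' le_rfl ?_
  rw [← ENNReal.tsum_mul_left]
  refine ENNReal.tsum_le_tsum fun m => ?_
  rw [ENNReal.tsum_mul_left, mul_comm]
  refine mul_le_mul' ?_ le_rfl
  calc ∑' i, (tentShifts hN m : Set (Fin d → ℤ)).indicator (1 : (Fin d → ℤ) → ℝ≥0∞) i
      ≤ ∑' i, ((nearCubes N 0).indicator (1 : (Fin d → ℤ) → ℝ≥0∞) i +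
          (nearCubes N m).indicator 1 i) := by
        refine ENNReal.tsum_le_tsum fun i => ?_
        refine Set.indicator_apply_le' (fun hi => ?_) fun _ => zero_le
        simp only [tentShifts, Set.Finite.coe_toFinset] at hi
        rcases hi with hi | hi
        · rw [Set.indicator_of_mem hi]
          exact le_self_add
        · rw [Set.indicator_of_mem hi]
          exact le_add_self
    _ ≤ _ := by
        rw [ENNReal.tsum_add, two_mul]
        exact add_le_add (tsum_indicator_nearCubes_le hN 0) (tsum_indicator_nearCubes_le hN m)

/-- Apply the left inverse `S` to `T χ_j u = χ_j T u + [T, χ_j] u` and expand `T` in the commutator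
into its diagonals. -/
theorem enorm_tentOp_le_add_conv (S T : L2 d H →L[ℂ] L2 d H) (hST : S * T = 1)
    (hT : ∑' l, diagSup (canonicalMatrix T) l ≠ ∞) {N : ℕ} (hN : 0 < N) (u : L2 d H)
    (j : Fin d → ℤ) :
    ‖tentOp N j u‖ₑ ≤ ‖S‖ₑ * ‖tentOp N j (T u)‖ₑ +
      (commutatorSeq (diagSup (canonicalMatrix T)) ‖S‖ₑ hN *
        (⟨fun j => ‖tentOp N j u‖ₑ⟩ : ConvSeq (Fin d → ℤ))) j := by
  set a := diagSup (canonicalMatrix T) with ha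
  have h1 : ‖tentOp N j u‖ₑ ≤ ‖S‖ₑ * ‖T (tentOp N j u)‖ₑ := by
    have : tentOp N j u = S (T (tentOp N j u)) := by
      rw [← mul_apply_eq_comp, hST, one_apply_eq_self]
    nth_rewrite 1 [this]
    exact S.le_opENorm _
  have h2 : HasSum (fun m => diagOp (canonicalMatrix T) (diagSup_ne_top hT) m (tentOp N j u) -
      tentOp N j (diagOp (canonicalMatrix T) (diagSup_ne_top hT) m u))
      (T (tentOp N j u) - tentOp N j (T u)) :=
    ((hasSum_diagOp T hT).mapL (ContinuousLinearMap.apply ℂ (L2 d H) (tentOp N j u))).sub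
      (((hasSum_diagOp T hT).mapL (ContinuousLinearMap.apply ℂ (L2 d H) u)).mapL (tentOp N j))
  have h3 : ‖T (tentOp N j u) - tentOp N j (T u)‖ₑ ≤
      ∑' m, a m * ENNReal.ofReal (damping N m) *
        ∑ i ∈ tentShifts hN m, ‖tentOp N (j - i) u‖ₑ := by
    rw [← h2.tsum_eq]
    exact enorm_tsum_le_tsum_enorm.trans
      (ENNReal.tsum_le_tsum fun m => enorm_diagOp_commutator_le _ _ hN j m u)
  have h4 : ‖S‖ₑ * ∑' m, a m * ENNReal.ofReal (damping N m) *
        ∑ i ∈ tentShifts hN m, ‖tentOp N (j - i) u‖ₑ =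
      (commutatorSeq a ‖S‖ₑ hN * (⟨fun j => ‖tentOp N j u‖ₑ⟩ : ConvSeq (Fin d → ℤ))) j := by
    simp only [ConvSeq.mul_apply, commutatorSeq, mul_assoc]
    rw [ENNReal.tsum_mul_left]
    simp only [← ENNReal.tsum_mul_right]
    rw [ENNReal.tsum_comm]
    congr 1
    refine tsum_congr fun m => ?_
    simp only [mul_assoc, ENNReal.tsum_mul_left]
    congr 2
    rw [tsum_eq_sum (s := tentShifts hN m)
      (fun i hi => by rw [Set.indicator_of_notMem (by simpa using hi), zero_mul])]
    refine Finset.sum_congr rfl fun i hi => ?_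
    rw [Set.indicator_of_mem (by simpa using hi), Pi.one_apply, one_mul]
  rw [← h4, ← mul_add]
  refine h1.trans (mul_le_mul' le_rfl ?_)
  calc ‖T (tentOp N j u)‖ₑ = ‖tentOp N j (T u) + (T (tentOp N j u) - tentOp N j (T u))‖ₑ := by
        rw [add_sub_cancel]
    _ ≤ _ := (enorm_add_le _ _).trans (by gcongr)

/-- Wiener's lemma for the unweighted Baskakov–Gohberg–Sjöstrand class. -/
theorem tsum_diagSup_inverse_lt_top (S T : L2 d H →L[ℂ] L2 d H) (hST : S * T = 1)
    (hTS : T * S = 1) (hT : ∑' l, diagSup (canonicalMatrix T) l ≠ ∞) :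
    ∑' l, diagSup (canonicalMatrix S) l < ∞ := by
  set a := diagSup (canonicalMatrix T) with ha
  obtain ⟨N, hNα, hN⟩ : ∃ N : ℕ, ‖S‖ₑ * (2 * ballCount d 4) *
      ∑' m, a m * ENNReal.ofReal (damping N m) < 1 ∧ 0 < N := by
    have hC : ‖S‖ₑ * (2 * ballCount d 4) ≠ ∞ :=
      ENNReal.mul_ne_top enorm_ne_top (ENNReal.mul_ne_top (by simp) (ballCount_lt_top d 4).ne)
    have h1 : Tendsto (fun N : ℕ => ∑' m, a m * ENNReal.ofReal (damping N m)) atTop (𝓝 0) := by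
      refine tendsto_tsum_mul_zero hT (fun N m => ?_) fun m => ?_
      · exact ENNReal.ofReal_le_one.2 (min_le_left _ _)
      · simpa using ENNReal.tendsto_ofReal (tendsto_damping m)
    have h2 := ENNReal.Tendsto.const_mul h1 (Or.inr hC)
    rw [mul_zero] at h2
    exact ((h2.eventually (gt_mem_nhds zero_lt_one)).and (eventually_gt_atTop 0)).exists
  set α := commutatorSeq a ‖S‖ₑ hN with hα
  have hα1 : ∑' i, α i < 1 := (tsum_commutatorSeq_le a ‖S‖ₑ hN).trans_lt hNα
  set β : ConvSeq (Fin d → ℤ) := ⟨fun i => ∑' n : ℕ, (α ^ n) i⟩ with hβ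
  -- The bound does not involve the row `k`: the cube of `k` and the support of the tent meeting `k
  -- - l` differ by a shift `i`, which forces `N • i` to be within `3 * N` of `l`.
  have key : ∀ l, diagSup (canonicalMatrix S) l ≤
      ∑' i, β i * (‖S‖ₑ * Set.indicator {l : Fin d → ℤ | ‖l - N • i‖ ≤ 3 * N} 1 l) := by
    intro l
    refine iSup_le fun k => ContinuousLinearMap.opENorm_le_bound _ fun v => ?_
    set u : L2 d H := S (lp.single 2 (k - l) v) with hu
    have hTu : T u = lp.single 2 (k - l) v := by
      rw [hu, ← mul_apply_eq_comp, hTS, one_apply_eq_self]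
    -- The a priori bound required to iterate is `‖u‖`; the result is read off at the cube of `k`,
    -- whose tent is `1` at `k`.
    have h1 := ConvSeq.le_tsum_pow_mul (a := α) (u := ⟨fun j => ‖tentOp N j u‖ₑ⟩)
      (f := ⟨fun j => ‖S‖ₑ * ‖tentOp N j (T u)‖ₑ⟩) (C := ‖u‖ₑ) enorm_ne_top
      (fun j => enorm_tentOp_apply_le N j u) hα1
      (fun j => enorm_tentOp_le_add_conv S T hST hT hN u j) (cubeIndex N k)
    refine ((enorm_apply_le_enorm_tentOp hN u k).trans h1).trans ?_
    rw [ConvSeq.mul_apply, ← ENNReal.tsum_mul_right]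
    refine ENNReal.tsum_le_tsum fun i => ?_
    rw [mul_assoc, mul_assoc]
    refine mul_le_mul' le_rfl (mul_le_mul' le_rfl ?_)
    rw [hTu]
    refine (enorm_tentOp_single_le hN _ _ v).trans (mul_le_mul' ?_ le_rfl)
    refine Set.indicator_apply_le' (fun hi => ?_) fun _ => zero_le
    rw [Set.indicator_of_mem]
    · rfl
    · have h2 : ‖k - l - N • (cubeIndex N k - i)‖ ≤ 2 * N := hi
      have h3 : l - N • i = (k - N • cubeIndex N k) - (k - l - N • (cubeIndex N k - i)) := by
        rw [smul_sub]
        abel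
      change ‖l - N • i‖ ≤ 3 * N
      rw [h3]
      exact (norm_sub_le _ _).trans (by linarith [norm_sub_nsmul_cubeIndex_le hN k])
  refine (ENNReal.tsum_le_tsum key).trans_lt ?_
  rw [ENNReal.tsum_comm]
  have h5 : ∀ i : Fin d → ℤ,
      ∑' l, Set.indicator {l : Fin d → ℤ | ‖l - N • i‖ ≤ 3 * N} (1 : (Fin d → ℤ) → ℝ≥0∞) l =
        ballCount d (3 * N) := fun i =>
    (Equiv.subRight (N • i)).tsum_eq
      (fun l => Set.indicator {l : Fin d → ℤ | ‖l‖ ≤ 3 * N} (1 : (Fin d → ℤ) → ℝ≥0∞) l)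
  simp only [ENNReal.tsum_mul_left, h5, ENNReal.tsum_mul_right]
  exact ENNReal.mul_lt_top (ConvSeq.tsum_tsum_pow_lt_top hα1)
    (ENNReal.mul_lt_top enorm_lt_top (ballCount_lt_top d _))

end Localization

/-! ### The class as an inverse closed and complete `*`-algebra -/

section Algebra

variable {d : ℕ} {H : Type*} [NormedAddCommGroup H] [InnerProductSpace ℂ H]
  {p : ℝ} {ν : (Fin d → ℤ) → ℝ≥0}

/-- The `p`-norm or norm of the class of an operator, as an extended nonnegative real number. -/
def classNorm (p : ℝ) (ν : (Fin d → ℤ) → ℝ≥0) (T : L2 d H →L[ℂ] L2 d H) : ℝ≥0∞ :=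
  seqNorm p ν (diagSup (canonicalMatrix T))

theorem classNorm_add_le (hp : 0 < p) (S T : L2 d H →L[ℂ] L2 d H) :
    classNorm p ν (S + T) ≤ classNorm p ν S + classNorm p ν T := by
  unfold classNorm
  rw [canonicalMatrix_add]
  exact (seqNorm_mono hp (diagSup_add_le _ _)).trans (seqNorm_add_le hp _ _)

theorem classNorm_smul (hp : 0 < p) (c : ℂ) (T : L2 d H →L[ℂ] L2 d H) :
    classNorm p ν (c • T) = ‖c‖ₑ ^ min p 1 * classNorm p ν T := by
  unfold classNorm
  rw [canonicalMatrix_smul, ← seqNorm_const_mul hp]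
  congr 1
  exact funext fun l => diagSup_smul c _ l

theorem classNorm_one_lt_top (hp : 0 < p) :
    classNorm p ν (1 : L2 d H →L[ℂ] L2 d H) < ∞ := by
  refine (seqNorm_mono hp diagSup_one_le).trans_lt ?_
  refine seqNorm_lt_top_of_finite_support hp _ {0} (fun l hl => ?_) fun l => ?_
  · rw [ConvSeq.one_apply, if_neg (by simpa using hl)]
  · rw [ConvSeq.one_apply]
    split_ifs <;> simp

theorem classNorm_mul_le (hp : 0 < p) (hν : IsAdmissible ν)
    (hpν : 1 < p → IsPAlgebraWeight p ν) (S T : L2 d H →L[ℂ] L2 d H) :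
    classNorm p ν (S * T) ≤ classNorm p ν S * classNorm p ν T :=
  (seqNorm_mono hp (diagSup_mul_le S T)).trans
    (seqNorm_mul_le hp hν.one_le hν.submul hpν _ _)

theorem classNorm_star [CompleteSpace H] (hν : IsAdmissible ν) (T : L2 d H →L[ℂ] L2 d H) :
    classNorm p ν (star T) = classNorm p ν T := by
  unfold classNorm
  rw [← seqNorm_comp_neg hν.symm (diagSup (canonicalMatrix T)).toFun]
  congr 1
  exact funext fun l => diagSup_star T l

theorem classNorm_eq_zero_iff (hp : 0 < p) (hν : IsAdmissible ν) (T : L2 d H →L[ℂ] L2 d H) :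
    classNorm p ν T = 0 ↔ T = 0 := by
  unfold classNorm
  rw [seqNorm_eq_zero_iff hp hν.one_le]
  constructor
  · intro h
    refine canonicalMatrix_injective (funext fun k => funext fun l => ?_)
    have h1 := enorm_le_diagSup (canonicalMatrix T) k (k - l)
    rw [h, sub_sub_cancel, nonpos_iff_eq_zero] at h1
    rw [← ofReal_norm, ENNReal.ofReal_eq_zero, norm_le_zero_iff] at h1
    rw [h1]
    ext v
    rfl
  · rintro rfl l
    rw [diagSup_apply, ← nonpos_iff_eq_zero]
    refine iSup_le fun k => ContinuousLinearMap.opENorm_le_bound _ fun v => ?_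
    rw [canonicalMatrix_apply]
    simp

theorem classNorm_sum_le (hp : 0 < p) {ι : Type*} (s : Finset ι)
    (T : ι → L2 d H →L[ℂ] L2 d H) :
    classNorm p ν (∑ i ∈ s, T i) ≤ ∑ i ∈ s, classNorm p ν (T i) := by
  classical
  induction s using Finset.induction_on with
  | empty =>
    rw [Finset.sum_empty, Finset.sum_empty, ← zero_smul ℂ (0 : L2 d H →L[ℂ] L2 d H),
      classNorm_smul hp, enorm_zero, ENNReal.zero_rpow_of_pos (lt_min hp one_pos), zero_mul]
  | insert a s ha ih =>
    rw [Finset.sum_insert ha, Finset.sum_insert ha]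
    exact (classNorm_add_le hp _ _).trans (by gcongr)

/-! ### Banded truncations -/

/-- The restriction of a matrix to the side diagonals with index in `s`. -/
def truncation (s : Finset (Fin d → ℤ)) (A : OpMatrix d H) : OpMatrix d H :=
  fun k l => if k - l ∈ s then A k l else 0

theorem diagSup_truncation_le (s : Finset (Fin d → ℤ)) (A : OpMatrix d H) (l : Fin d → ℤ) :
    diagSup (truncation s A) l ≤ (s : Set (Fin d → ℤ)).indicator (diagSup A) l := by
  refine iSup_le fun k => ?_
  simp only [truncation, sub_sub_cancel]
  split_ifs with h
  · rw [Set.indicator_of_mem (by exact h)]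
    exact enorm_le_diagSup A k l
  · exact (enorm_zero (E := H →L[ℂ] H)).trans_le zero_le

theorem diagSup_sub_truncation_le (s : Finset (Fin d → ℤ)) (A : OpMatrix d H) (l : Fin d → ℤ) :
    diagSup (A - truncation s A) l ≤ (s : Set (Fin d → ℤ))ᶜ.indicator (diagSup A) l := by
  refine iSup_le fun k => ?_
  simp only [Pi.sub_apply, truncation, sub_sub_cancel]
  split_ifs with h
  · rw [sub_self]
    exact (enorm_zero (E := H →L[ℂ] H)).trans_le zero_le
  · rw [sub_zero, Set.indicator_of_mem (by simpa using h)]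
    exact enorm_le_diagSup A k l

/-! ### The `*`-algebra of the class -/

variable [CompleteSpace H]

/-- The operators whose canonical matrix belongs to the class form a `*`-algebra. -/
def bgsStarSubalgebra (H : Type*) [NormedAddCommGroup H] [InnerProductSpace ℂ H]
    [CompleteSpace H] (hp : 0 < p) (hν : IsAdmissible ν)
    (hpν : 1 < p → IsPAlgebraWeight p ν) : StarSubalgebra ℂ (L2 d H →L[ℂ] L2 d H) where
  carrier := {T | classNorm p ν T < ∞}
  mul_mem' {S T} hS hT := (classNorm_mul_le hp hν hpν S T).trans_lt (ENNReal.mul_lt_top hS hT)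
  add_mem' {S T} hS hT := (classNorm_add_le hp S T).trans_lt (ENNReal.add_lt_top.2 ⟨hS, hT⟩)
  algebraMap_mem' c := by
    rw [Algebra.algebraMap_eq_smul_one]
    change classNorm p ν _ < ∞
    rw [classNorm_smul hp]
    exact ENNReal.mul_lt_top (ENNReal.rpow_lt_top_of_nonneg (lt_min hp one_pos).le enorm_ne_top)
      (classNorm_one_lt_top hp)
  star_mem' {T} hT := (classNorm_star hν T).trans_lt hT

/-- Wiener's lemma for the weighted Baskakov–Gohberg–Sjöstrand class. -/
theorem classNorm_inverse_lt_top (hp : 0 < p) (hν : IsAdmissible ν)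
    (hpν : 1 < p → IsPAlgebraWeight p ν)
    (hpν' : 1 < p → ∑' n, (ν n : ℝ≥0∞) ^ (-p.conjExponent) < ∞)
    (S T : L2 d H →L[ℂ] L2 d H) (hST : S * T = 1) (hTS : T * S = 1)
    (hT : classNorm p ν T < ∞) : classNorm p ν S < ∞ := by
  set 𝒮 := bgsStarSubalgebra H hp hν hpν with h𝒮
  have hT1 : ∑' l, diagSup (canonicalMatrix T) l < ∞ :=
    tsum_lt_top_of_seqNorm_lt_top hp hν.one_le hpν' hT
  have hS1 : ∑' l, diagSup (canonicalMatrix S) l < ∞ :=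
    tsum_diagSup_inverse_lt_top S T hST hTS hT1.ne
  -- The `ℓ¹` norm is the case `p = 1`, `ν = 1`, so the tail estimate applies to `S`, not yet known
  -- to be in the weighted class.
  have hone : ∀ a : (Fin d → ℤ) → ℝ≥0∞, seqNorm 1 1 a = ∑' l, a l := fun a => by
    simp [seqNorm, weightedSum]
  obtain ⟨s, hs⟩ : ∃ s : Finset (Fin d → ℤ), (∑' l, diagSup (canonicalMatrix T) l) *
      ∑' l, (s : Set (Fin d → ℤ))ᶜ.indicator (diagSup (canonicalMatrix S)) l < 1 := by
    have hδ : 0 < (∑' l, diagSup (canonicalMatrix T) l)⁻¹ := ENNReal.inv_pos.2 hT1.ne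
    obtain ⟨s, hs⟩ := exists_finset_seqNorm_indicator_compl_lt (p := 1) (ν := 1) one_pos
      ((hone _).trans_lt hS1) hδ
    rw [hone] at hs
    exact ⟨s, ENNReal.mul_lt_of_lt_div' (by rwa [one_div])⟩
  set A := truncation s (canonicalMatrix S) with hA
  have hAfin : ∑' l, diagSup A l < ∞ :=
    lt_of_le_of_lt (ENNReal.tsum_le_tsum fun l => (diagSup_truncation_le s _ l).trans
      (Set.indicator_le_self' (by simp) l)) hS1
  set B : L2 d H →L[ℂ] L2 d H := matrixOp A hAfin.ne with hB
  have hBA : canonicalMatrix B = A := canonicalMatrix_matrixOp A hAfin.ne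
  -- Only finitely many diagonals are nonzero and each is bounded, so the weight is harmless.
  have hBmem : B ∈ 𝒮 := by
    change seqNorm p ν (diagSup (canonicalMatrix B)) < ∞
    rw [hBA]
    refine seqNorm_lt_top_of_finite_support hp _ s (fun l hl => ?_)
      fun l => (ENNReal.le_tsum l).trans_lt hAfin
    rw [← nonpos_iff_eq_zero]
    refine (diagSup_truncation_le s _ l).trans (le_of_eq ?_)
    exact Set.indicator_of_notMem (by simpa using hl) _
  -- Two forms of `R` are used: `1 - T B` shows that it belongs to the class, `T (S - B)` that its
  -- `ℓ¹` norm is below `1`.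
  set R := 1 - T * B with hR
  have hRmem : R ∈ 𝒮 := sub_mem (one_mem _) (mul_mem hT hBmem)
  have hRE : R = T * (S - B) := by rw [mul_sub, hTS]
  have hR1 : ∑' l, diagSup (canonicalMatrix R) l < 1 := by
    rw [hRE]
    refine lt_of_le_of_lt ((ENNReal.tsum_le_tsum fun l => diagSup_mul_le T (S - B) l).trans
      (ConvSeq.tsum_mul_le _ _)) (lt_of_le_of_lt ?_ hs)
    gcongr with l
    rw [canonicalMatrix_sub, hBA]
    exact diagSup_sub_truncation_le s _ l
  have hRn : ‖R‖ < 1 := by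
    have := (enorm_le_tsum_diagSup R).trans_lt hR1
    rw [← ofReal_norm] at this
    exact ENNReal.ofReal_lt_one.1 this
  set G := ∑' n : ℕ, R ^ n with hG
  have hGmem : G ∈ 𝒮 := by
    have h1 : ∑' n : ℕ, classNorm p ν (R ^ n) < ∞ :=
      lt_of_le_of_lt (ENNReal.tsum_le_tsum fun n => seqNorm_mono hp (diagSup_pow_le R n))
        (tsum_seqNorm_pow_lt_top hp hν hpν _ hRmem hR1)
    have h2 : HasSum (fun n : ℕ => R ^ n) G := (summable_geometric_of_norm_lt_one hRn).hasSum
    -- The series converges in operator norm with partial sums in a fixed ball of the class; that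
    -- ball is closed, so completeness of the class is not needed.
    refine lt_of_le_of_lt (seqNorm_le_of_tendsto hp ν h2 (Eventually.of_forall fun t => ?_)) h1
    exact (classNorm_sum_le hp t _).trans (ENNReal.sum_le_tsum t)
  have hinv : T * B * G = 1 := by
    have := mul_neg_geom_series R hRn
    rwa [hR, sub_sub_cancel] at this
  have hSBG : S = B * G := by
    rw [← mul_one S, ← hinv, ← mul_assoc, ← mul_assoc, hST, one_mul]
  rw [hSBG]
  exact mul_mem (S := StarSubalgebra ℂ (L2 d H →L[ℂ] L2 d H)) (s := 𝒮) hBmem hGmem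

theorem isInverseClosed_bgsStarSubalgebra (hp : 0 < p) (hν : IsAdmissible ν)
    (hpν : 1 < p → IsPAlgebraWeight p ν)
    (hpν' : 1 < p → ∑' n, (ν n : ℝ≥0∞) ^ (-p.conjExponent) < ∞) :
    IsInverseClosed (bgsStarSubalgebra H hp hν hpν).toSubalgebra := by
  rintro ⟨T, hT⟩ ⟨⟨_, S, hTS, hST⟩, rfl⟩
  have hS := classNorm_inverse_lt_top hp hν hpν hpν' S _ hST hTS hT
  exact ⟨⟨⟨_, hT⟩, ⟨S, hS⟩, Subtype.ext hTS, Subtype.ext hST⟩, rfl⟩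

/-- An inverse closed `*`-subalgebra of a `C*`-algebra is symmetric. -/
theorem IsInverseClosed.isSymmetricAlgebra {ℬ : Type*} [CStarAlgebra ℬ] (S : StarSubalgebra ℂ ℬ)
    (hS : IsInverseClosed S.toSubalgebra) : IsSymmetricAlgebra S := by
  intro a z hz
  -- Inverse closedness puts the spectrum in the subalgebra inside that in `ℬ`, where `a a*` is a
  -- positive element.
  have hz' : z ∈ spectrum ℂ ((a : ℬ) * star (a : ℬ)) := by
    rw [spectrum.mem_iff] at hz ⊢
    exact fun h => hz (hS (algebraMap ℂ S z - a * star a) h)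
  have hsa : IsSelfAdjoint ((a : ℬ) * star (a : ℬ)) := IsSelfAdjoint.mul_star_self _
  have hre := hsa.mem_spectrum_eq_re hz'
  refine ⟨z.re, ?_, hre.symm⟩
  have h1 : z.re ∈ spectrum ℝ ((a : ℬ) * star (a : ℬ)) := by
    rw [← spectrum.algebraMap_mem_iff ℂ]
    rw [hre] at hz'
    exact hz'
  have h2 := spectrum_star_mul_self_nonneg (b := star (a : ℬ)) z.re
  rw [star_star] at h2
  exact h2 h1

theorem isPBanachStarAlgebra_bgsStarSubalgebra (hp : 0 < p) (hν : IsAdmissible ν)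
    (hpν : 1 < p → IsPAlgebraWeight p ν)
    (hpν' : 1 < p → ∑' n, (ν n : ℝ≥0∞) ^ (-p.conjExponent) < ∞) :
    IsPBanachStarAlgebra (min p 1) (fun T : bgsStarSubalgebra H hp hν hpν =>
      (classNorm p ν (T : L2 d H →L[ℂ] L2 d H)).toReal) where
  nonneg _ := ENNReal.toReal_nonneg
  eq_zero_iff a := by
    rw [ENNReal.toReal_eq_zero_iff, or_iff_left (show classNorm p ν _ < ∞ from a.2).ne,
      classNorm_eq_zero_iff hp hν]
    exact ZeroMemClass.coe_eq_zero
  add_le a b := by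
    rw [← ENNReal.toReal_add (show classNorm p ν _ < ∞ from a.2).ne
      (show classNorm p ν _ < ∞ from b.2).ne]
    exact ENNReal.toReal_mono (ENNReal.add_lt_top.2 ⟨a.2, b.2⟩).ne (classNorm_add_le hp _ _)
  smul_eq c a := by
    have h := classNorm_smul (ν := ν) hp c (a : L2 d H →L[ℂ] L2 d H)
    rw [← toReal_enorm, ENNReal.toReal_rpow, ← ENNReal.toReal_mul, ← h]
    rfl
  mul_le a b := by
    rw [← ENNReal.toReal_mul]
    exact ENNReal.toReal_mono (ENNReal.mul_lt_top a.2 b.2).ne (classNorm_mul_le hp hν hpν _ _)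
  star_eq a := congrArg ENNReal.toReal (classNorm_star hν (a : L2 d H →L[ℂ] L2 d H))
  complete u hu := by
    have hr : 0 < min p 1 := lt_min hp one_pos
    obtain ⟨K, hK, hKle⟩ := exists_tsum_le_mul_seqNorm_rpow (ν := ν) hp hν.one_le hpν'
    set v : ℕ → L2 d H →L[ℂ] L2 d H := fun n => u n with hv
    have hfin : ∀ m n, classNorm p ν (v m - v n) ≠ ∞ := fun m n => (u m - u n).2.ne
    have hcauchy : CauchySeq v := by
      rw [Metric.cauchySeq_iff]
      intro ε hε
      -- The operator norm is at most `K` times the class norm to the power `1 / min p 1`, so a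
      -- Cauchy sequence of the class is Cauchy in operator norm.
      have h1 : Tendsto (fun t : ℝ => K * ENNReal.ofReal t ^ (1 / min p 1)) (𝓝 0) (𝓝 0) := by
        have h2 : Continuous fun t : ℝ => K * ENNReal.ofReal t ^ (1 / min p 1) :=
          (ENNReal.continuous_const_mul hK).comp
            (ENNReal.continuous_rpow_const.comp ENNReal.continuous_ofReal)
        have h3 := h2.tendsto 0
        rwa [ENNReal.ofReal_zero, ENNReal.zero_rpow_of_pos (by positivity), mul_zero] at h3
      obtain ⟨δ, hδ, hδε⟩ := Metric.eventually_nhds_iff.1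
        (h1.eventually (gt_mem_nhds (ENNReal.ofReal_pos.2 hε)))
      obtain ⟨n₀, hn₀⟩ := hu δ hδ
      refine ⟨n₀, fun m hm n hn => ?_⟩
      have h4 : (classNorm p ν (v m - v n)).toReal < δ := hn₀ m hm n hn
      have h5 := hδε (y := (classNorm p ν (v m - v n)).toReal)
        (by rwa [Real.dist_eq, sub_zero, abs_of_nonneg ENNReal.toReal_nonneg])
      rw [ENNReal.ofReal_toReal (hfin m n)] at h5
      have h6 := ((enorm_le_tsum_diagSup (v m - v n)).trans (hKle _)).trans_lt h5
      rw [dist_eq_norm]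
      rw [← ofReal_norm] at h6
      exact (ENNReal.ofReal_lt_ofReal_iff hε).1 h6
    obtain ⟨T, hT⟩ := cauchySeq_tendsto_of_complete hcauchy
    have hlim : ∀ ε > 0, ∃ n₀, ∀ n ≥ n₀, classNorm p ν (v n - T) ≤ ENNReal.ofReal ε := by
      intro ε hε
      obtain ⟨n₀, hn₀⟩ := hu ε hε
      refine ⟨n₀, fun n hn => ?_⟩
      -- Let `m → ∞` in the bound for `v n - v m`: closed balls of the class survive operator norm
      -- limits.
      refine seqNorm_le_of_tendsto hp ν (hT.const_sub (v n)) ?_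
      filter_upwards [eventually_ge_atTop n₀] with m hm
      have h4 : (classNorm p ν (v n - v m)).toReal < ε := hn₀ n hn m hm
      exact (ENNReal.le_ofReal_iff_toReal_le (hfin n m) hε.le).2 h4.le
    have hTmem : T ∈ bgsStarSubalgebra H hp hν hpν := by
      obtain ⟨n₀, hn₀⟩ := hlim 1 one_pos
      have h1 : v n₀ - T ∈ bgsStarSubalgebra H hp hν hpν :=
        (hn₀ n₀ le_rfl).trans_lt ENNReal.ofReal_lt_top
      have h2 := sub_mem (u n₀).2 h1
      rwa [show (u n₀ : L2 d H →L[ℂ] L2 d H) - (v n₀ - T) = T from sub_sub_cancel _ _] at h2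
    refine ⟨⟨T, hTmem⟩, ?_⟩
    rw [Metric.tendsto_atTop]
    intro ε hε
    obtain ⟨n₀, hn₀⟩ := hlim (ε / 2) (half_pos hε)
    refine ⟨n₀, fun n hn => ?_⟩
    rw [Real.dist_eq, sub_zero, abs_of_nonneg ENNReal.toReal_nonneg]
    have h1 : (classNorm p ν (v n - T)).toReal ≤ ε / 2 :=
      ENNReal.toReal_le_of_le_ofReal (half_pos hε).le (hn₀ n hn)
    exact lt_of_le_of_lt h1 (half_lt_self hε)

end Algebra

end BGS

end

theorem theorem4p4 {d : ℕ} {H : Type*} [NormedAddCommGroup H] [InnerProductSpace ℂ H]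
    [CompleteSpace H] (p : ℝ) (hp : 0 < p) (ν : (Fin d → ℤ) → ℝ≥0) (hν : BGS.IsAdmissible ν)
    (hpν : 1 < p → BGS.IsPAlgebraWeight p ν ∧
      ∑' n, (ν n : ℝ≥0∞) ^ (-p.conjExponent) < ∞) :
    -- every matrix in `C^p_ν` acts as a bounded operator on `ℓ²(ℤ^d, H)`
    (∀ A ∈ BGS.bgsClass d H p ν, ∃ T : BGS.L2 d H →L[ℂ] BGS.L2 d H,
      ∀ (x : BGS.L2 d H) (k : Fin d → ℤ), HasSum (fun l => A k l (x l)) (T x k)) ∧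
    -- these operators form a unital `*`-subalgebra `S` of `B(ℓ²(ℤ^d, H))`
    ∃ S : StarSubalgebra ℂ (BGS.L2 d H →L[ℂ] BGS.L2 d H),
      (∀ T, T ∈ S ↔ BGS.canonicalMatrix T ∈ BGS.bgsClass d H p ν) ∧
      BGS.IsInverseClosed S.toSubalgebra ∧
      BGS.IsPBanachStarAlgebra (min p 1)
        (fun T : S => BGS.bgsNorm p ν (BGS.canonicalMatrix (T : BGS.L2 d H →L[ℂ] BGS.L2 d H))) ∧
      BGS.IsSymmetricAlgebra S := by
  have h1 : 1 < p → BGS.IsPAlgebraWeight p ν := fun h => (hpν h).1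
  have h2 : 1 < p → ∑' n, (ν n : ℝ≥0∞) ^ (-p.conjExponent) < ∞ := fun h => (hpν h).2
  have hinv := BGS.isInverseClosed_bgsStarSubalgebra (H := H) hp hν h1 h2
  refine ⟨fun A hA => ?_, BGS.bgsStarSubalgebra H hp hν h1, fun T => ?_, hinv, ?_,
    hinv.isSymmetricAlgebra⟩
  · have hA' := BGS.tsum_lt_top_of_seqNorm_lt_top hp hν.one_le h2
      ((BGS.mem_bgsClass_iff hp ν A).1 hA)
    exact ⟨BGS.matrixOp A hA'.ne, BGS.hasSum_matrixOp_apply A hA'.ne⟩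
  · exact (BGS.mem_bgsClass_iff hp ν _).symm
  · simp only [BGS.bgsNorm_eq_toReal_seqNorm]
    exact BGS.isPBanachStarAlgebra_bgsStarSubalgebra hp hν h1 h2
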